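/- Let $\omega_A,\omega_c\in\mathbb R$, $\gamma>0$, $g,z\in\mathbb C$, and put $\Delta\omega=\omega_A-\omega_c$, $\Gamma=-i\Delta\omega+\tfrac12\gamma$, so that $|\Gamma|^2=\Delta\omega^2+\tfrac14\gamma^2>0$. Consider a two-level atom ($A$), with raising and lowering operators $\sigma^\pm$, coupled to a damped bosonic mode ($B$), with annihilation operator $b$, through the generators $$\mathcal L_0=-i[\omega_A\sigma^+\sigma^-+\omega_c b^\dagger b,\,\cdot\,]+\gamma\big(b\cdot b^\dagger-\tfrac12\{b^\dagger b,\cdot\}\big),\qquad \mathcal L=-i[g\sigma^+b+\bar g\sigma^-b^\dagger,\,\cdot\,].$$ Let $|z\rangle$ be the coherent state, $b|z\rangle=z|z\rangle$, let $\mathcal P=\mathrm{tr}_B(\cdot)\otimes|z\rangle\langle z|$ and $\mathcal L(t)=e^{-\mathcal L_0t}\mathcal Le^{\mathcal L_0t}$, and define the moments $$\mathcal O_k(t)=\int_0^t dt_1\cdots\int_0^{t_{k-1}}dt_k\;\mathcal P e^{\mathcal L_0t}\mathcal L(t_1)\cdots\mathcal L(t_k)\mathcal P,\qquad \mathcal O_0(t)=\mathcal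 Pe^{\mathcal L_0t}\mathcal P,$$ and the cumulants $$\mathcal K_n(t)=\sum_{q=0}^n(-1)^q\sum_{\substack{k_0+\dots+k_q=n\\ k_0\ge0,\;k_1,\dots,k_q\ge1}}\dot{\mathcal O}_{k_0}\mathcal O_0^{-1}\mathcal O_{k_1}\mathcal O_0^{-1}\cdots\mathcal O_{k_q}\mathcal O_0^{-1},$$ all regarded, after omission of the constant factor $\otimes|z\rangle\langle z|$, as maps on $2\times2$ matrices. (Superoperators act on matrices in the number basis of the mode, and $e^{\mathcal L_0t}$ is the exponential series, taken matrix element by matrix element.) Then all objects entering the cumulants of order at most four exist: the series and integrals converge, the moments are differentiable in $t$, and $\mathcal O_0(t)$ is invertible. The following limits exist for every $2\times 2$ matrix $\rho$. 1. As $t\to\infty$, $\mathcal K_2(t)\rho$ converges to the GKSL generator $-i[H^{(2)},\rho]+L^{(2)}\rho L^{(2)\dagger}-\tfrac12\{L^{(2)\dagger}L^{(2)},\rho\}$ with $$H^{(2)}=\frac{|g|^2\Delta\omega}{|\Gamma|^2}\,\sigma^+\sigma^-,\qquad L^{(2)}=\frac{\sqrt\gamma\,|g|}{|\Gamma|}\,\sigma^-.$$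 2. As $t\to\infty$, the fourth-order cumulant converges to a correction of the unitary and dissipative parts of this generator: $$\mathcal K_4(t)\rho\;\to\;-i[H^{(4)},\rho]+|g|^4\frac{\gamma(|\Gamma|^2-4\Delta\omega^2)}{|\Gamma|^6}\Big(\sigma^-\rho\,\sigma^+-\tfrac12\{\sigma^+\sigma^-,\rho\}\Big),\qquad H^{(4)}=|g|^4\frac{\Delta\omega(\gamma^2-|\Gamma|^2)}{|\Gamma|^6}\,\sigma^+\sigma^-.$$ 3. If $4\Delta\omega^2\le|\Gamma|^2$, this limit is the GKSL generator $-i[H^{(4)},\rho]+L^{(4)}\rho L^{(4)\dagger}-\tfrac12\{L^{(4)\dagger}L^{(4)},\rho\}$ with Lindblad operator $$L^{(4)}=|g|^2\sqrt{\frac{\gamma(|\Gamma|^2-4\Delta\omega^2)}{|\Gamma|^6}}\;\sigma^-.$$ 4. If $g\ne0$, the fourth-order cumulant does not vanish as $t\to\infty$: it is not true that $\mathcal K_4(t)\rho\to0$ for every $\rho$. -/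

import Mathlib

open Filter Topology MeasureTheory
open scoped Kronecker

noncomputable section

namespace JaynesCummings

/-! ### Operators as (possibly infinite) matrices

Operators of the two-level system `A` are matrices indexed by `Fin 2` (index `1` is the excited
level), operators of the bosonic mode `B` are matrices in the number basis indexed by `ℕ`, and
operators of the composite system are matrices indexed by `Fin 2 × ℕ`. -/

/-- Operators (in particular density matrices) of the two-level system. -/
abbrev OpA := Matrix (Fin 2) (Fin 2) ℂ

/-- Operators of the bosonic mode, in the number basis. -/
abbrev OpB := Matrix ℕ ℕ ℂ

/-- Operators of the composite system, in the product basis. -/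
abbrev OpAB := Matrix (Fin 2 × ℕ) (Fin 2 × ℕ) ℂ

/-- The product of two matrices with arbitrary index sets. -/
def mulOp {ι : Type*} (X Y : Matrix ι ι ℂ) : Matrix ι ι ℂ :=
  fun i j => ∑' k, X i k * Y k j

/-- The commutator `[X, Y] = X Y - Y X`. -/
def commOp {ι : Type*} (X Y : Matrix ι ι ℂ) : Matrix ι ι ℂ :=
  mulOp X Y - mulOp Y X

/-- The dissipator with jump operator `L`: `L X L† - ½ (L† L X + X L† L)`. -/
def dissipator {ι : Type*} (L X : Matrix ι ι ℂ) : Matrix ι ι ℂ :=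
  mulOp (mulOp L X) L.conjTranspose
    - (1 / 2 : ℂ) • (mulOp (mulOp L.conjTranspose L) X + mulOp X (mulOp L.conjTranspose L))

/-- The GKSL generator with Hamiltonian `H` and Lindblad operator `L`:
`X ↦ -i [H, X] + L X L† - ½ {L† L, X}`. -/
def gksl {ι : Type*} (H L X : Matrix ι ι ℂ) : Matrix ι ι ℂ :=
  (-Complex.I) • commOp H X + dissipator L X

/-- The raising operator `σ⁺ = |1⟩⟨0|`. -/
def sigmaPlus : OpA := !![0, 0; 1, 0]

/-- The lowering operator `σ⁻ = |0⟩⟨1|`. -/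
def sigmaMinus : OpA := !![0, 1; 0, 0]

/-- The annihilation operator: `⟨m| b |n⟩ = √n` if `m + 1 = n`, and `0` otherwise. -/
def annihilation : OpB := fun m n => if m + 1 = n then ((Real.sqrt n : ℝ) : ℂ) else 0

/-- The creation operator `b†`. -/
def creation : OpB := annihilation.conjTranspose

/-- Number-basis coefficients of the coherent state:
`⟨n|z⟩ = exp (-|z|² / 2) zⁿ / √(n!)`. -/
def coherentVec (z : ℂ) (n : ℕ) : ℂ :=
  ((Real.exp (-‖z‖ ^ 2 / 2) : ℝ) : ℂ) * z ^ n / ((Real.sqrt (Nat.factorial n) : ℝ) : ℂ)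

/-- The projection `|z⟩⟨z|` on a coherent state. -/
def coherentState (z : ℂ) : OpB := fun m n => coherentVec z m * star (coherentVec z n)

/-- The partial trace over the bosonic mode. -/
def partialTrace (X : OpAB) : OpA := fun a b => ∑' n : ℕ, X (a, n) (b, n)

/-! ### The model -/

/-- Parameters of the Jaynes-Cummings model with a damped mode: the frequencies of the atom and of
the mode, the damping rate, the coupling constant, and the amplitude of the coherent state. -/
structure Params where
  omegaA : ℝ
  omegaC : ℝ
  gamma : ℝ
  g : ℂ
  z : ℂ

namespace Params

variable (p : Params)

/-- The detuning `Δω = ω_A - ω_c`. -/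
def detuning : ℝ := p.omegaA - p.omegaC

/-- `Γ = -i (ω_A - ω_c) + γ / 2`. -/
def Gam : ℂ := -Complex.I * ((p.omegaA - p.omegaC : ℝ) : ℂ) + (p.gamma : ℂ) / 2

/-- The free Hamiltonian `ω_A σ⁺σ⁻ + ω_c b†b`. -/
def freeHamiltonian : OpAB :=
  (p.omegaA : ℂ) • ((sigmaPlus * sigmaMinus) ⊗ₖ (1 : OpB))
    + (p.omegaC : ℂ) • ((1 : OpA) ⊗ₖ mulOp creation annihilation)

/-- The interaction Hamiltonian `g σ⁺ b + ḡ σ⁻ b†`. -/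
def interactionHamiltonian : OpAB :=
  p.g • (sigmaPlus ⊗ₖ annihilation) + star p.g • (sigmaMinus ⊗ₖ creation)

/-- The free generator `𝓛₀ = -i [H_A + H_B, ·] + γ (b · b† - ½ {b†b, ·})`. -/
def freeGen (X : OpAB) : OpAB :=
  (-Complex.I) • commOp p.freeHamiltonian X
    + (p.gamma : ℂ) • dissipator ((1 : OpA) ⊗ₖ annihilation) X

/-- The interaction generator `𝓛 = -i [H_I, ·]`. -/
def intGen (X : OpAB) : OpAB := (-Complex.I) • commOp p.interactionHamiltonian X

/-- The `n`-th term `(tⁿ / n!) 𝓛₀ⁿ X` of the exponential series. -/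
def expTerm (t : ℝ) (X : OpAB) (n : ℕ) : OpAB :=
  (((t ^ n / (Nat.factorial n : ℝ) : ℝ)) : ℂ) • (p.freeGen^[n] X)

/-- The free evolution `e^{𝓛₀ t} X = ∑ₙ (tⁿ / n!) 𝓛₀ⁿ X`, for `t` of either sign; the series is
taken matrix element by matrix element. -/
def expFree (t : ℝ) (X : OpAB) : OpAB := fun i j => ∑' n : ℕ, p.expTerm t X n i j

/-- `𝓛(t) = e^{-𝓛₀ t} 𝓛 e^{𝓛₀ t}`. -/
def intGenAt (t : ℝ) (X : OpAB) : OpAB := p.expFree (-t) (p.intGen (p.expFree t X))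

/-- `𝓛(t₁) ⋯ 𝓛(t_k) (ρ ⊗ |z⟩⟨z|)` for a list of times `[t₁, …, t_k]`. -/
def insertions (ρ : OpA) (l : List ℝ) : OpAB :=
  l.foldr (fun s X => p.intGenAt s X) (ρ ⊗ₖ coherentState p.z)

/-- The integrand of the moments, `tr_B (e^{𝓛₀ t} 𝓛(t₁) ⋯ 𝓛(t_k) (ρ ⊗ |z⟩⟨z|))`. -/
def momentIntegrand (t : ℝ) (ρ : OpA) (l : List ℝ) : OpA :=
  partialTrace (p.expFree t (p.insertions ρ l))

end Params

/-- The ordered integral `∫₀ᵗ dt₁ ∫₀^{t₁} dt₂ ⋯ ∫₀^{t_{k-1}} dt_k F [t₁, …, t_k]`. -/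
def orderedIntegral : ℕ → ℝ → (List ℝ → ℂ) → ℂ
  | 0, _, F => F []
  | k + 1, t, F => ∫ s in (0 : ℝ)..t, orderedIntegral k s (fun l => F (s :: l))

/-- All the integrals in `orderedIntegral k t F` are integrals of integrable functions. -/
def OrderedIntegrable : ℕ → ℝ → (List ℝ → ℂ) → Prop
  | 0, _, _ => True
  | k + 1, t, F =>
      IntervalIntegrable (fun s => orderedIntegral k s (fun l => F (s :: l))) volume 0 t
        ∧ ∀ s ∈ Set.uIcc 0 t, OrderedIntegrable k s (fun l => F (s :: l))

namespace Params

variable (p : Params)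

/-- The moment `𝓞_k(t)`. For the projector `𝓟 = tr_B(·) ⊗ |z⟩⟨z|` one has
`𝓞_k(t) (ρ ⊗ |z⟩⟨z|) = (moment k t ρ) ⊗ |z⟩⟨z|`; the constant factor `⊗ |z⟩⟨z|` is omitted, so that
moments and cumulants act on the operators of the two-level system. -/
def moment (k : ℕ) (t : ℝ) (ρ : OpA) : OpA :=
  fun a b => orderedIntegral k t (fun l => p.momentIntegrand t ρ l a b)

/-- The time derivative of the moment. -/
def momentDeriv (k : ℕ) (t : ℝ) (ρ : OpA) : OpA :=
  fun a b => deriv (fun s => p.moment k s ρ a b) t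

/-- The inverse `𝓞₀(t)⁻¹`. -/
def momentZeroInv (t : ℝ) : OpA → OpA := Function.invFun (p.moment 0 t)

/-- The product `𝓞̇_{k₀} 𝓞₀⁻¹ 𝓞_{k₁} 𝓞₀⁻¹ ⋯ 𝓞_{k_q} 𝓞₀⁻¹` at time `t`, applied to `ρ`. -/
def cumulantTerm (t : ℝ) (ρ : OpA) (q : ℕ) (k : Fin (q + 1) → ℕ) : OpA :=
  p.momentDeriv (k 0) t (p.momentZeroInv t
    ((List.ofFn (fun j : Fin q => k j.succ)).foldr
      (fun m X => p.moment m t (p.momentZeroInv t X)) ρ))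

/-- The cumulant `𝓚_n(t)`: the alternating sum of `cumulantTerm` over all `q ≤ n` and all
`k₀ ≥ 0`, `k₁, …, k_q ≥ 1` with `k₀ + ⋯ + k_q = n`. -/
def cumulant (n : ℕ) (t : ℝ) (ρ : OpA) : OpA :=
  ∑ q ∈ Finset.range (n + 1),
    (-1 : ℂ) ^ q •
      ∑ k ∈ (Finset.Nat.antidiagonalTuple (q + 1) n).filter
          (fun k => ∀ j : Fin q, 1 ≤ k j.succ),
        p.cumulantTerm t ρ q k

/-- The objects that enter the cumulants of order at most `n` exist: the exponential series, the
partial traces and the ordered integrals converge, the moments are differentiable in time, and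
`𝓞₀(t)` is invertible. -/
structure WellDefined (n : ℕ) : Prop where
  summable_exp : ∀ (ρ : OpA) (l : List ℝ), l.length ≤ n → ∀ (t : ℝ) (i j : Fin 2 × ℕ),
    Summable (fun m => p.expTerm t (p.insertions ρ l) m i j)
  summable_exp_neg : ∀ (ρ : OpA) (l : List ℝ), l.length < n → ∀ (t : ℝ) (i j : Fin 2 × ℕ),
    Summable (fun m => p.expTerm (-t) (p.intGen (p.expFree t (p.insertions ρ l))) m i j)
  summable_trace : ∀ (ρ : OpA) (l : List ℝ), l.length ≤ n → ∀ (t : ℝ) (a b : Fin 2),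
    Summable (fun m : ℕ => p.expFree t (p.insertions ρ l) (a, m) (b, m))
  integrable : ∀ (ρ : OpA) (k : ℕ), k ≤ n → ∀ (t : ℝ) (a b : Fin 2),
    OrderedIntegrable k t (fun l => p.momentIntegrand t ρ l a b)
  differentiable : ∀ (ρ : OpA) (k : ℕ), k ≤ n → ∀ (a b : Fin 2),
    Differentiable ℝ (fun t => p.moment k t ρ a b)
  bijective : ∀ t : ℝ, Function.Bijective (p.moment 0 t)

/-- The Hamiltonian `H⁽²⁾ = (|g|² Δω / |Γ|²) σ⁺σ⁻`. -/
def H2 : OpA :=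
  ((‖p.g‖ ^ 2 * p.detuning / ‖p.Gam‖ ^ 2 : ℝ) : ℂ) • (sigmaPlus * sigmaMinus)

/-- The Lindblad operator `L⁽²⁾ = (√γ |g| / |Γ|) σ⁻`. -/
def L2 : OpA := ((Real.sqrt p.gamma * ‖p.g‖ / ‖p.Gam‖ : ℝ) : ℂ) • sigmaMinus

/-- The Hamiltonian `H⁽⁴⁾ = |g|⁴ (Δω (γ² - |Γ|²) / |Γ|⁶) σ⁺σ⁻`. -/
def H4 : OpA :=
  ((‖p.g‖ ^ 4 * (p.detuning * (p.gamma ^ 2 - ‖p.Gam‖ ^ 2) / ‖p.Gam‖ ^ 6) : ℝ) : ℂ) •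
    (sigmaPlus * sigmaMinus)

/-- The rate `|g|⁴ γ (|Γ|² - 4 Δω²) / |Γ|⁶`, which may have either sign. -/
def rate4 : ℝ :=
  ‖p.g‖ ^ 4 * (p.gamma * (‖p.Gam‖ ^ 2 - 4 * p.detuning ^ 2) / ‖p.Gam‖ ^ 6)

/-- The Lindblad operator `L⁽⁴⁾ = |g|² √(γ (|Γ|² - 4 Δω²) / |Γ|⁶) σ⁻`, meaningful when
`4 Δω² ≤ |Γ|²`. -/
def L4 : OpA :=
  ((‖p.g‖ ^ 2 *
      Real.sqrt (p.gamma * (‖p.Gam‖ ^ 2 - 4 * p.detuning ^ 2) / ‖p.Gam‖ ^ 6) : ℝ) : ℂ) •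
    sigmaMinus

end Params

end JaynesCummings

end

/-! Everything happens in the span of derivatives `∂ᵤʲ∂ᵥᵏ K(u,v)` of the coherent kernel `K(u,v) =
e^{-uv} ∑ uᵐvⁿ/√(m!n!) |m⟩⟨n|`, with coefficients that are operators of the atom. On this span
`[b†,·]` and `[·,b]` are `∂ᵤ` and `∂ᵥ`, and `K` is an eigenvector of `b·` and `·b†`. With `κ = iω_c
+ γ/2`, the damped mode therefore acts as the first-order operator `-κu∂ᵤ - κ̄v∂ᵥ`. Its flow moves
the base point to `(ze^{-κt}, z̄e^{-κ̄t})` and multiplies a derivative of order `(j,k)` by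
`e^{-(jκ+kκ̄)t}`. The evolved entries are entire in `t`, so their Taylor series are the exponential
series, for either sign of `t` (`hasSum_expTerm`). As `tr K = 1` identically, the partial trace sees
only the coefficient of order `(0,0)` (`hasSum_trace_evolved`).

In the interaction picture `𝓛(t)` becomes an explicit map of coefficients (`intGen_evolved`), with
`A = -ig[σ⁺,·]` and `B = -iḡ[σ⁻,·]` lowering or preserving the derivative order, and `C = -iḡσ⁻·`
and `D = ig·σ⁺` raising it. Its ordered integrals `cₙ,ᵢⱼ` solve a closed linear hierarchy. Up to the
free rotation of the atom the moments are the `cₙ,₀₀`, and the cumulants are the orders of the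
formal quotient `ċ₀₀ c₀₀⁻¹`.

Multiplying `cᵢⱼ` by `e^{-(iΓ+jΓ̄)t}` gives rescaled coefficients `Sᵢⱼ`, whose equations have
constant coefficients apart from a drive proportional to `z`, `z̄` that decays. With `W = S₁₀c₀₀⁻¹`
and `W̃ = S₀₁c₀₀⁻¹`, the time-local generator is `drive + AW + BW̃`. Each order of `W` obeys `y' =
-Γy + f` with convergent `f`, hence tends to `Γ⁻¹ lim f` (`tendsto_of_damped_linear`). So `z` drops
out: order two tends to `Γ⁻¹AC + Γ̄⁻¹BD`, and order four follows from `C² = D² = 0` and the limit of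
`S₁₁` (`tendsto_localGen4`). Both limits are amplitude-damping generators: on the entry `(1,0)` they
are multiplication by `-|g|²Γ⁻¹` and `-|g|⁴Γ⁻³`, whose real and imaginary parts give the rates and
shifts. They commute with the free rotation, which is isometric, so the limits persist in the
Schrödinger picture. -/

noncomputable section

namespace JaynesCummings

/-! ### Ladder superoperators of the mode -/

/-- Left multiplication by the annihilation operator, `X ↦ b X`. -/
def leftLower : Module.End ℂ OpB where
  toFun X := fun m n => ((Real.sqrt ((m + 1 : ℕ) : ℝ) : ℝ) : ℂ) * X (m + 1) n
  map_add' X Y := by ext m n; exact mul_add _ _ _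
  map_smul' c X := by ext m n; exact mul_left_comm _ _ _

/-- Left multiplication by the creation operator, `X ↦ b† X`. -/
def leftRaise : Module.End ℂ OpB where
  toFun X := fun m n => ((Real.sqrt (m : ℝ) : ℝ) : ℂ) * X (m - 1) n
  map_add' X Y := by ext m n; exact mul_add _ _ _
  map_smul' c X := by ext m n; exact mul_left_comm _ _ _

/-- Right multiplication by the creation operator, `X ↦ X b†`. -/
def rightLower : Module.End ℂ OpB where
  toFun X := fun m n => ((Real.sqrt ((n + 1 : ℕ) : ℝ) : ℝ) : ℂ) * X m (n + 1)
  map_add' X Y := by ext m n; exact mul_add _ _ _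
  map_smul' c X := by ext m n; exact mul_left_comm _ _ _

/-- Right multiplication by the annihilation operator, `X ↦ X b`. -/
def rightRaise : Module.End ℂ OpB where
  toFun X := fun m n => ((Real.sqrt (n : ℝ) : ℝ) : ℂ) * X m (n - 1)
  map_add' X Y := by ext m n; exact mul_add _ _ _
  map_smul' c X := by ext m n; exact mul_left_comm _ _ _

theorem leftLower_apply (X : OpB) (m n : ℕ) :
    leftLower X m n = ((Real.sqrt ((m + 1 : ℕ) : ℝ) : ℝ) : ℂ) * X (m + 1) n := rfl

theorem leftRaise_apply (X : OpB) (m n : ℕ) :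
    leftRaise X m n = ((Real.sqrt (m : ℝ) : ℝ) : ℂ) * X (m - 1) n := rfl

theorem rightLower_apply (X : OpB) (m n : ℕ) :
    rightLower X m n = ((Real.sqrt ((n + 1 : ℕ) : ℝ) : ℝ) : ℂ) * X m (n + 1) := rfl

theorem rightRaise_apply (X : OpB) (m n : ℕ) :
    rightRaise X m n = ((Real.sqrt (n : ℝ) : ℝ) : ℂ) * X m (n - 1) := rfl

theorem sqrt_mul_sqrt_natCast (n : ℕ) :
    ((Real.sqrt (n : ℝ) : ℝ) : ℂ) * ((Real.sqrt (n : ℝ) : ℝ) : ℂ) = n := by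
  rw [← Complex.ofReal_mul, Real.mul_self_sqrt (Nat.cast_nonneg n), Complex.ofReal_natCast]

theorem leftLower_mul_leftRaise : leftLower * leftRaise = leftRaise * leftLower + 1 := by
  refine LinearMap.ext fun X => ?_
  ext m n
  simp only [Module.End.mul_apply, LinearMap.add_apply, Module.End.one_apply, Matrix.add_apply,
    leftLower_apply, leftRaise_apply, ← mul_assoc, sqrt_mul_sqrt_natCast]
  -- At `m = 0` the truncated index `m - 1` is harmless because `√0 = 0`; there only the `1`
  -- survives.
  rcases m with _ | m
  · simp
  · simp only [Nat.add_sub_cancel, sqrt_mul_sqrt_natCast]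
    push_cast; ring

theorem rightLower_mul_rightRaise : rightLower * rightRaise = rightRaise * rightLower + 1 := by
  refine LinearMap.ext fun X => ?_
  ext m n
  simp only [Module.End.mul_apply, LinearMap.add_apply, Module.End.one_apply, Matrix.add_apply,
    rightLower_apply, rightRaise_apply, ← mul_assoc, sqrt_mul_sqrt_natCast]
  rcases n with _ | n
  · simp
  · simp only [Nat.add_sub_cancel, sqrt_mul_sqrt_natCast]
    push_cast; ring

theorem commute_leftLower_rightLower : Commute leftLower rightLower := by
  refine LinearMap.ext fun X => ?_
  ext m n
  simp only [Module.End.mul_apply, leftLower_apply, rightLower_apply]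
  ring

theorem commute_leftLower_rightRaise : Commute leftLower rightRaise := by
  refine LinearMap.ext fun X => ?_
  ext m n
  simp only [Module.End.mul_apply, leftLower_apply, rightRaise_apply]
  ring

theorem commute_leftRaise_rightLower : Commute leftRaise rightLower := by
  refine LinearMap.ext fun X => ?_
  ext m n
  simp only [Module.End.mul_apply, leftRaise_apply, rightLower_apply]
  ring

theorem commute_leftRaise_rightRaise : Commute leftRaise rightRaise := by
  refine LinearMap.ext fun X => ?_
  ext m n
  simp only [Module.End.mul_apply, leftRaise_apply, rightRaise_apply]
  ring

/-- The commutator `X ↦ [b†, X]`, which acts on coherent kernels as `∂/∂u`. -/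
def dLeft : Module.End ℂ OpB := leftRaise - rightLower

/-- The commutator `X ↦ [X, b]`, which acts on coherent kernels as `∂/∂v`. -/
def dRight : Module.End ℂ OpB := rightRaise - leftLower

/-- The canonical commutators on the left and on the right contribute `+1` and `-1`, which cancel.
-/
theorem commute_dLeft_dRight : Commute dLeft dRight := by
  have h1 := leftLower_mul_leftRaise
  have h2 := rightLower_mul_rightRaise
  have h3 := commute_leftLower_rightLower.eq
  have h4 := commute_leftRaise_rightRaise.eq
  simp only [Commute, SemiconjBy, dLeft, dRight, sub_mul, mul_sub, h1, h2, h3, h4]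
  abel

/-- With the three statements that follow, `(b·, [b†,·])` and `(·b†, [·,b])` become two commuting
Weyl pairs, which is all the algebra that the kernel derivatives need. -/
theorem leftLower_mul_dLeft : leftLower * dLeft = dLeft * leftLower + 1 := by
  simp only [dLeft, mul_sub, sub_mul, leftLower_mul_leftRaise, commute_leftLower_rightLower.eq]
  abel

theorem rightLower_mul_dRight : rightLower * dRight = dRight * rightLower + 1 := by
  simp only [dRight, mul_sub, sub_mul, rightLower_mul_rightRaise, commute_leftLower_rightLower.eq]
  abel

theorem commute_leftLower_dRight : Commute leftLower dRight :=
  commute_leftLower_rightRaise.sub_right (Commute.refl _)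

theorem commute_rightLower_dLeft : Commute rightLower dLeft :=
  commute_leftRaise_rightLower.symm.sub_right (Commute.refl _)

theorem mul_pow_of_mul_eq_add_one {R : Type*} [Ring R] {a d : R} (h : a * d = d * a + 1) (j : ℕ) :
    a * d ^ j = d ^ j * a + j • d ^ (j - 1) := by
  induction j with
  | zero => simp
  | succ j ih =>
    rw [pow_succ, ← mul_assoc, ih, add_mul, mul_assoc, h]
    rcases j with _ | j
    · simp
    · simp only [Nat.add_sub_cancel, mul_add, mul_one, smul_mul_assoc, ← pow_succ, ← mul_assoc]
      rw [add_assoc, ← succ_nsmul', ]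

/-! ### Derivatives of the coherent kernel -/

/-- The operator `e^{-uv} ∑ₘₙ uᵐ vⁿ / √(m! n!) |m⟩⟨n|`. -/
def coherentKernel (u v : ℂ) : OpB := fun m n =>
  Complex.exp (-(u * v)) * (u ^ m / ((Real.sqrt (Nat.factorial m) : ℝ) : ℂ))
    * (v ^ n / ((Real.sqrt (Nat.factorial n) : ℝ) : ℂ))

theorem sqrt_factorial_ne_zero (n : ℕ) : ((Real.sqrt (Nat.factorial n) : ℝ) : ℂ) ≠ 0 := by
  rw [Complex.ofReal_ne_zero]
  exact (Real.sqrt_pos.mpr (by exact_mod_cast Nat.factorial_pos n)).ne'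

theorem sqrt_factorial_succ (n : ℕ) : ((Real.sqrt (Nat.factorial (n + 1)) : ℝ) : ℂ)
    = ((Real.sqrt ((n + 1 : ℕ) : ℝ) : ℝ) : ℂ) * ((Real.sqrt (Nat.factorial n) : ℝ) : ℂ) := by
  rw [← Complex.ofReal_mul, ← Real.sqrt_mul (Nat.cast_nonneg _), Nat.factorial_succ]
  push_cast; rfl

theorem sqrt_succ_ne_zero (n : ℕ) : ((Real.sqrt ((n + 1 : ℕ) : ℝ) : ℝ) : ℂ) ≠ 0 := by
  rw [Complex.ofReal_ne_zero]
  exact (Real.sqrt_pos.mpr (by exact_mod_cast Nat.succ_pos n)).ne'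

theorem leftLower_coherentKernel (u v : ℂ) :
    leftLower (coherentKernel u v) = u • coherentKernel u v := by
  ext m n
  simp only [leftLower_apply, coherentKernel, Matrix.smul_apply, smul_eq_mul, sqrt_factorial_succ]
  have := sqrt_succ_ne_zero m
  have := sqrt_factorial_ne_zero m
  have := sqrt_factorial_ne_zero n
  field_simp
  ring

theorem rightLower_coherentKernel (u v : ℂ) :
    rightLower (coherentKernel u v) = v • coherentKernel u v := by
  ext m n
  simp only [rightLower_apply, coherentKernel, Matrix.smul_apply, smul_eq_mul, sqrt_factorial_succ]
  have := sqrt_succ_ne_zero n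
  have := sqrt_factorial_ne_zero m
  have := sqrt_factorial_ne_zero n
  field_simp
  ring

/-- The derivative `∂ᵤʲ ∂ᵥᵏ` of the coherent kernel. -/
def kernelDeriv (u v : ℂ) (j k : ℕ) : OpB := (dLeft ^ j * dRight ^ k) (coherentKernel u v)

theorem dLeft_kernelDeriv (u v : ℂ) (j k : ℕ) :
    dLeft (kernelDeriv u v j k) = kernelDeriv u v (j + 1) k := by
  simp only [kernelDeriv, ← Module.End.mul_apply, ← mul_assoc, ← pow_succ']

theorem dRight_kernelDeriv (u v : ℂ) (j k : ℕ) :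
    dRight (kernelDeriv u v j k) = kernelDeriv u v j (k + 1) := by
  simp only [kernelDeriv, ← Module.End.mul_apply]
  rw [← mul_assoc, ← (commute_dLeft_dRight.pow_left j).eq, mul_assoc, ← pow_succ']

/-- This is the Leibniz rule `∂ᵤʲ(uK) = u∂ᵤʲK + j∂ᵤʲ⁻¹K`, since `bK = uK`. At `j = 0` the truncated
order `j - 1` carries the coefficient `0`. -/
theorem leftLower_kernelDeriv (u v : ℂ) (j k : ℕ) :
    leftLower (kernelDeriv u v j k)
      = u • kernelDeriv u v j k + (j : ℂ) • kernelDeriv u v (j - 1) k := by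
  simp only [kernelDeriv, ← Module.End.mul_apply]
  rw [← mul_assoc, mul_pow_of_mul_eq_add_one leftLower_mul_dLeft, add_mul, mul_assoc,
    (commute_leftLower_dRight.pow_right k).eq, ← mul_assoc, LinearMap.add_apply,
    Module.End.mul_apply _ leftLower, leftLower_coherentKernel, map_smul, smul_mul_assoc,
    LinearMap.smul_apply, Nat.cast_smul_eq_nsmul]

theorem rightLower_kernelDeriv (u v : ℂ) (j k : ℕ) :
    rightLower (kernelDeriv u v j k)
      = v • kernelDeriv u v j k + (k : ℂ) • kernelDeriv u v j (k - 1) := by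
  simp only [kernelDeriv, ← Module.End.mul_apply]
  rw [← mul_assoc, (commute_rightLower_dLeft.pow_right j).eq, mul_assoc,
    mul_pow_of_mul_eq_add_one rightLower_mul_dRight, mul_add, LinearMap.add_apply, ← mul_assoc,
    Module.End.mul_apply _ rightLower, rightLower_coherentKernel, map_smul, mul_smul_comm,
    LinearMap.smul_apply, Nat.cast_smul_eq_nsmul]

theorem leftRaise_kernelDeriv (u v : ℂ) (j k : ℕ) :
    leftRaise (kernelDeriv u v j k) = kernelDeriv u v (j + 1) k
      + v • kernelDeriv u v j k + (k : ℂ) • kernelDeriv u v j (k - 1) := by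
  have h : leftRaise = dLeft + rightLower := by simp [dLeft]
  rw [h, LinearMap.add_apply, dLeft_kernelDeriv, rightLower_kernelDeriv, add_assoc]

theorem rightRaise_kernelDeriv (u v : ℂ) (j k : ℕ) :
    rightRaise (kernelDeriv u v j k) = kernelDeriv u v j (k + 1)
      + u • kernelDeriv u v j k + (j : ℂ) • kernelDeriv u v (j - 1) k := by
  have h : rightRaise = dRight + leftLower := by simp [dRight]
  rw [h, LinearMap.add_apply, dRight_kernelDeriv, leftLower_kernelDeriv, add_assoc]

/-! ### Differentiation of operator-valued functions, entry by entry -/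

/-- Entrywise differentiability of a family of operators. -/
def HasEntryDeriv (Y : ℂ → OpB) (Y' : OpB) (t : ℂ) : Prop :=
  ∀ m n, HasDerivAt (fun s => Y s m n) (Y' m n) t

theorem HasEntryDeriv.dLeft {Y : ℂ → OpB} {Y' : OpB} {t : ℂ} (h : HasEntryDeriv Y Y' t) :
    HasEntryDeriv (fun s => dLeft (Y s)) (dLeft Y') t := fun m n =>
  ((h (m - 1) n).const_mul _).sub ((h m (n + 1)).const_mul _)

theorem HasEntryDeriv.dRight {Y : ℂ → OpB} {Y' : OpB} {t : ℂ} (h : HasEntryDeriv Y Y' t) :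
    HasEntryDeriv (fun s => dRight (Y s)) (dRight Y') t := fun m n =>
  ((h m (n - 1)).const_mul _).sub ((h (m + 1) n).const_mul _)

theorem hasDerivAt_pow_div_sqrt_factorial {f : ℂ → ℂ} {f' t : ℂ} (h : HasDerivAt f f' t) (m : ℕ) :
    HasDerivAt (fun s => f s ^ m / ((Real.sqrt (Nat.factorial m) : ℝ) : ℂ))
      (((Real.sqrt (m : ℝ) : ℝ) : ℂ) *
        (f t ^ (m - 1) / ((Real.sqrt (Nat.factorial (m - 1)) : ℝ) : ℂ)) * f') t := by
  refine ((h.pow m).div_const _).congr_deriv ?_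
  rcases m with _ | m
  · simp
  · have h1 := sqrt_succ_ne_zero m
    have h2 := sqrt_factorial_ne_zero m
    have h3 := sqrt_mul_sqrt_natCast (m + 1)
    simp only [Nat.add_sub_cancel, sqrt_factorial_succ]
    rw [← h3]
    field_simp

/-- In `∂ᵤK` the monomial `uᵐ/√m!` gives `b†K` and the prefactor `e^{-uv}` gives `-vK = -Kb†`, so
the sum is the commutator `[b†,K]`; similarly for `∂ᵥ`. -/
theorem hasEntryDeriv_coherentKernel {f₁ f₂ : ℂ → ℂ} {f₁' f₂' t : ℂ} (h₁ : HasDerivAt f₁ f₁' t)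
    (h₂ : HasDerivAt f₂ f₂' t) :
    HasEntryDeriv (fun s => coherentKernel (f₁ s) (f₂ s))
      (f₁' • kernelDeriv (f₁ t) (f₂ t) 1 0 + f₂' • kernelDeriv (f₁ t) (f₂ t) 0 1) t := by
  intro m n
  have h1 : kernelDeriv (f₁ t) (f₂ t) 1 0 = leftRaise (coherentKernel (f₁ t) (f₂ t))
      - f₂ t • coherentKernel (f₁ t) (f₂ t) := by
    simp [kernelDeriv, dLeft, rightLower_coherentKernel]
  have h2 : kernelDeriv (f₁ t) (f₂ t) 0 1 = rightRaise (coherentKernel (f₁ t) (f₂ t))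
      - f₁ t • coherentKernel (f₁ t) (f₂ t) := by
    simp [kernelDeriv, dRight, leftLower_coherentKernel]
  rw [h1, h2]
  refine (((h₁.mul h₂).neg.cexp.mul (hasDerivAt_pow_div_sqrt_factorial h₁ m)).mul
    (hasDerivAt_pow_div_sqrt_factorial h₂ n)).congr_deriv ?_
  simp only [Matrix.add_apply, Matrix.sub_apply, Matrix.smul_apply, smul_eq_mul, leftRaise_apply,
    rightRaise_apply, coherentKernel, Pi.mul_apply, Pi.neg_apply]
  ring

/-- Each entry of `dLeft` or `dRight` combines two entries with constant coefficients, so both pass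
through entrywise differentiation and the orders can be raised one at a time. -/
theorem hasEntryDeriv_kernelDeriv {f₁ f₂ : ℂ → ℂ} {f₁' f₂' t : ℂ} (h₁ : HasDerivAt f₁ f₁' t)
    (h₂ : HasDerivAt f₂ f₂' t) (j k : ℕ) :
    HasEntryDeriv (fun s => kernelDeriv (f₁ s) (f₂ s) j k)
      (f₁' • kernelDeriv (f₁ t) (f₂ t) (j + 1) k
        + f₂' • kernelDeriv (f₁ t) (f₂ t) j (k + 1)) t := by
  induction j with
  | zero =>
    induction k with
    | zero => exact hasEntryDeriv_coherentKernel h₁ h₂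
    | succ k ih =>
      have := ih.dRight
      simpa only [map_add, map_smul, dRight_kernelDeriv] using this
  | succ j ih =>
    have := ih.dLeft
    simpa only [map_add, map_smul, dLeft_kernelDeriv] using this

/-! ### Rapid decay and the trace -/

/-- Operators whose entries are dominated by `C r^(m+n) / √(m! n!)`. -/
def IsRapid (X : OpB) : Prop :=
  ∃ C r : ℝ, 0 ≤ C ∧ 1 ≤ r ∧
    ∀ m n, ‖X m n‖ ≤ C * (r ^ m / Real.sqrt (Nat.factorial m))
      * (r ^ n / Real.sqrt (Nat.factorial n))

theorem isRapid_coherentKernel (u v : ℂ) : IsRapid (coherentKernel u v) := by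
  refine ⟨‖Complex.exp (-(u * v))‖, max 1 (max ‖u‖ ‖v‖), norm_nonneg _, le_max_left _ _,
    fun m n => ?_⟩
  simp only [coherentKernel, norm_mul, norm_div, norm_pow, Complex.norm_real, Real.norm_eq_abs,
    abs_of_nonneg (Real.sqrt_nonneg _)]
  gcongr
  · exact (le_max_left _ _).trans (le_max_right _ _)
  · exact (le_max_right _ _).trans (le_max_right _ _)

theorem IsRapid.sub {X Y : OpB} (hX : IsRapid X) (hY : IsRapid Y) : IsRapid (X - Y) := by
  obtain ⟨C, r, hC, hr, h⟩ := hX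
  obtain ⟨D, s, hD, hs, h'⟩ := hY
  refine ⟨C + D, max r s, by positivity, hr.trans (le_max_left _ _), fun m n => ?_⟩
  have h0 : 0 ≤ r := by linarith
  have h1 : 0 ≤ s := by linarith
  calc ‖(X - Y) m n‖ ≤ ‖X m n‖ + ‖Y m n‖ := norm_sub_le _ _
    _ ≤ C * ((max r s) ^ m / Real.sqrt (Nat.factorial m)) *
          ((max r s) ^ n / Real.sqrt (Nat.factorial n))
        + D * ((max r s) ^ m / Real.sqrt (Nat.factorial m)) *
          ((max r s) ^ n / Real.sqrt (Nat.factorial n)) := by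
        refine add_le_add ((h m n).trans ?_) ((h' m n).trans ?_)
        · gcongr <;> exact le_max_left _ _
        · gcongr <;> exact le_max_right _ _
    _ = _ := by ring

/-- Raising costs a factor `m ≤ 2ᵐ`, absorbed by doubling the radius; this is why `IsRapid` leaves
`r` free. -/
theorem sqrt_mul_pow_pred_div_le {r : ℝ} (hr : 1 ≤ r) (m : ℕ) :
    Real.sqrt m * (r ^ (m - 1) / Real.sqrt (Nat.factorial (m - 1)))
      ≤ (2 * r) ^ m / Real.sqrt (Nat.factorial m) := by
  rcases m with _ | m
  · simp
  · have h1 : 0 < Real.sqrt ((m + 1 : ℕ) : ℝ) := Real.sqrt_pos.mpr (by positivity)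
    have h2 : 0 < Real.sqrt (Nat.factorial m) := Real.sqrt_pos.mpr (by positivity)
    have h3 : Real.sqrt (Nat.factorial (m + 1))
        = Real.sqrt ((m + 1 : ℕ) : ℝ) * Real.sqrt (Nat.factorial m) := by
      rw [← Real.sqrt_mul (Nat.cast_nonneg _), Nat.factorial_succ]; push_cast; rfl
    have h4 : ((m + 1 : ℕ) : ℝ) ≤ 2 ^ (m + 1) := by exact_mod_cast (m + 1).lt_two_pow_self.le
    have h5 := Real.mul_self_sqrt (Nat.cast_nonneg (α := ℝ) (m + 1))
    rw [Nat.add_sub_cancel, h3, le_div_iff₀ (by positivity)]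
    calc _ = (Real.sqrt ((m + 1 : ℕ) : ℝ) * Real.sqrt ((m + 1 : ℕ) : ℝ)) * r ^ m := by
          field_simp
      _ ≤ 2 ^ (m + 1) * r ^ (m + 1) := by
          rw [h5]; gcongr; exact Nat.le_succ m
      _ = _ := by rw [mul_pow]

theorem sqrt_succ_mul_pow_succ_div {r : ℝ} (m : ℕ) :
    Real.sqrt ((m + 1 : ℕ) : ℝ) * (r ^ (m + 1) / Real.sqrt (Nat.factorial (m + 1)))
      = r * (r ^ m / Real.sqrt (Nat.factorial m)) := by
  have h1 : 0 < Real.sqrt ((m + 1 : ℕ) : ℝ) := Real.sqrt_pos.mpr (by positivity)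
  have h2 : 0 < Real.sqrt (Nat.factorial m) := Real.sqrt_pos.mpr (by positivity)
  have h3 : Real.sqrt (Nat.factorial (m + 1))
      = Real.sqrt ((m + 1 : ℕ) : ℝ) * Real.sqrt (Nat.factorial m) := by
    rw [← Real.sqrt_mul (Nat.cast_nonneg _), Nat.factorial_succ]; push_cast; rfl
  rw [h3]; field_simp; ring

theorem norm_sqrt_mul (x : ℝ) (w : ℂ) : ‖((Real.sqrt x : ℝ) : ℂ) * w‖ = Real.sqrt x * ‖w‖ := by
  rw [norm_mul, Complex.norm_real, Real.norm_eq_abs, abs_of_nonneg (Real.sqrt_nonneg _)]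

theorem IsRapid.leftRaise {X : OpB} (hX : IsRapid X) : IsRapid (leftRaise X) := by
  obtain ⟨C, r, hC, hr, h⟩ := hX
  refine ⟨C, 2 * r, hC, by linarith, fun m n => ?_⟩
  rw [leftRaise_apply, norm_sqrt_mul]
  calc _ ≤ Real.sqrt m * (C * (r ^ (m - 1) / Real.sqrt (Nat.factorial (m - 1)))
      * (r ^ n / Real.sqrt (Nat.factorial n))) := by gcongr; exact h _ _
    _ = C * (Real.sqrt m * (r ^ (m - 1) / Real.sqrt (Nat.factorial (m - 1))))
      * (r ^ n / Real.sqrt (Nat.factorial n)) := by ring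
    _ ≤ _ := by
      gcongr
      · exact sqrt_mul_pow_pred_div_le hr m
      · linarith

theorem IsRapid.rightRaise {X : OpB} (hX : IsRapid X) : IsRapid (rightRaise X) := by
  obtain ⟨C, r, hC, hr, h⟩ := hX
  refine ⟨C, 2 * r, hC, by linarith, fun m n => ?_⟩
  rw [rightRaise_apply, norm_sqrt_mul]
  calc _ ≤ Real.sqrt n * (C * (r ^ m / Real.sqrt (Nat.factorial m))
      * (r ^ (n - 1) / Real.sqrt (Nat.factorial (n - 1)))) := by gcongr; exact h _ _
    _ = C * (r ^ m / Real.sqrt (Nat.factorial m))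
      * (Real.sqrt n * (r ^ (n - 1) / Real.sqrt (Nat.factorial (n - 1)))) := by ring
    _ ≤ _ := by
      gcongr
      · linarith
      · exact sqrt_mul_pow_pred_div_le hr n

theorem IsRapid.leftLower {X : OpB} (hX : IsRapid X) : IsRapid (leftLower X) := by
  obtain ⟨C, r, hC, hr, h⟩ := hX
  refine ⟨C * r, r, by positivity, hr, fun m n => ?_⟩
  rw [leftLower_apply, norm_sqrt_mul]
  calc _ ≤ Real.sqrt ((m + 1 : ℕ) : ℝ) * (C * (r ^ (m + 1) / Real.sqrt (Nat.factorial (m + 1)))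
      * (r ^ n / Real.sqrt (Nat.factorial n))) := by gcongr; exact h _ _
    _ = C * (Real.sqrt ((m + 1 : ℕ) : ℝ) * (r ^ (m + 1) / Real.sqrt (Nat.factorial (m + 1))))
      * (r ^ n / Real.sqrt (Nat.factorial n)) := by ring
    _ = _ := by rw [sqrt_succ_mul_pow_succ_div]; ring

theorem IsRapid.rightLower {X : OpB} (hX : IsRapid X) : IsRapid (rightLower X) := by
  obtain ⟨C, r, hC, hr, h⟩ := hX
  refine ⟨C * r, r, by positivity, hr, fun m n => ?_⟩
  rw [rightLower_apply, norm_sqrt_mul]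
  calc _ ≤ Real.sqrt ((n + 1 : ℕ) : ℝ) * (C * (r ^ m / Real.sqrt (Nat.factorial m))
      * (r ^ (n + 1) / Real.sqrt (Nat.factorial (n + 1)))) := by gcongr; exact h _ _
    _ = C * (r ^ m / Real.sqrt (Nat.factorial m))
      * (Real.sqrt ((n + 1 : ℕ) : ℝ) * (r ^ (n + 1) / Real.sqrt (Nat.factorial (n + 1)))) := by
        ring
    _ = _ := by rw [sqrt_succ_mul_pow_succ_div]; ring

theorem isRapid_kernelDeriv (u v : ℂ) (j k : ℕ) : IsRapid (kernelDeriv u v j k) := by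
  induction j with
  | zero =>
    induction k with
    | zero => exact isRapid_coherentKernel u v
    | succ k ih => rw [← dRight_kernelDeriv]; exact ih.rightRaise.sub ih.leftLower
  | succ j ih => rw [← dLeft_kernelDeriv]; exact ih.leftRaise.sub ih.rightLower

theorem IsRapid.summable_diag {X : OpB} (hX : IsRapid X) : Summable (fun n => X n n) := by
  obtain ⟨C, r, hC, hr, h⟩ := hX
  refine Summable.of_norm_bounded (g := fun n => C * ((r * r) ^ n / (Nat.factorial n : ℝ)))
    ((Real.summable_pow_div_factorial (r * r)).mul_left C) fun n => (h n n).trans_eq ?_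
  have h2 : 0 < Real.sqrt (Nat.factorial n) := Real.sqrt_pos.mpr (by positivity)
  have h5 := Real.mul_self_sqrt (Nat.cast_nonneg (α := ℝ) (Nat.factorial n))
  rw [← h5, Real.sqrt_mul_self h2.le, mul_pow]
  field_simp

theorem hasSum_sub_shift {f : ℕ → ℂ} (hf : Summable f) :
    HasSum (fun n => f n - f (n + 1)) (f 0) := by
  have h1 := (hasSum_nat_add_iff' 1).mpr hf.hasSum
  simpa using hf.hasSum.sub h1

/-- A commutator with the unbounded `b†` need not be traceless in general. Here the diagonal
telescopes, rapid decay makes both halves summable, and the boundary term contains `√0`. -/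
theorem IsRapid.hasSum_diag_dLeft {X : OpB} (hX : IsRapid X) :
    HasSum (fun n => dLeft X n n) 0 := by
  have h := hasSum_sub_shift hX.leftRaise.summable_diag
  rw [leftRaise_apply, Nat.cast_zero, Real.sqrt_zero, Complex.ofReal_zero, zero_mul] at h
  exact h

theorem IsRapid.hasSum_diag_dRight {X : OpB} (hX : IsRapid X) :
    HasSum (fun n => dRight X n n) 0 := by
  have h := hasSum_sub_shift hX.rightRaise.summable_diag
  rw [rightRaise_apply, Nat.cast_zero, Real.sqrt_zero, Complex.ofReal_zero, zero_mul] at h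
  exact h

theorem hasSum_diag_coherentKernel (u v : ℂ) :
    HasSum (fun n => coherentKernel u v n n) 1 := by
  have h := (NormedSpace.expSeries_div_hasSum_exp (u * v)).mul_left (Complex.exp (-(u * v)))
  rw [← Complex.exp_eq_exp_ℂ, ← Complex.exp_add, neg_add_cancel, Complex.exp_zero] at h
  refine (?_ : (fun n => coherentKernel u v n n) = _) ▸ h
  funext n
  have h1 := sqrt_factorial_ne_zero n
  have h2 := sqrt_mul_sqrt_natCast (Nat.factorial n)
  rw [coherentKernel, ← h2, mul_pow]
  field_simp

/-- The trace of `K(u,v)` is constantly `1`, so the trace of any proper derivative vanishes. -/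
theorem hasSum_diag_kernelDeriv (u v : ℂ) (j k : ℕ) :
    HasSum (fun n => kernelDeriv u v j k n n) (if j = 0 ∧ k = 0 then 1 else 0) := by
  rcases j with _ | j
  · rcases k with _ | k
    · simpa [kernelDeriv] using hasSum_diag_coherentKernel u v
    · simpa [dRight_kernelDeriv] using (isRapid_kernelDeriv u v 0 k).hasSum_diag_dRight
  · simpa [dLeft_kernelDeriv] using (isRapid_kernelDeriv u v j k).hasSum_diag_dLeft

/-! ### Products with sparse matrices -/

theorem mulOp_eq_single {ι : Type*} {X Y : Matrix ι ι ℂ} {i j : ι} (k : ι)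
    (h : ∀ l, l ≠ k → X i l * Y l j = 0) : mulOp X Y i j = X i k * Y k j :=
  tsum_eq_single k h

theorem mulOp_diagonal_left {ι : Type*} [DecidableEq ι] (d : ι → ℂ) (X : Matrix ι ι ℂ) (i j : ι) :
    mulOp (Matrix.diagonal d) X i j = d i * X i j := by
  rw [mulOp_eq_single i fun l hl => by rw [Matrix.diagonal_apply_ne' _ hl, zero_mul],
    Matrix.diagonal_apply_eq]

theorem mulOp_diagonal_right {ι : Type*} [DecidableEq ι] (d : ι → ℂ) (X : Matrix ι ι ℂ) (i j : ι) :
    mulOp X (Matrix.diagonal d) i j = X i j * d j := by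
  rw [mulOp_eq_single j fun l hl => by rw [Matrix.diagonal_apply_ne _ hl, mul_zero],
    Matrix.diagonal_apply_eq]

theorem creation_apply (m n : ℕ) :
    creation m n = if n + 1 = m then ((Real.sqrt m : ℝ) : ℂ) else 0 := by
  simp only [creation, Matrix.conjTranspose_apply, annihilation]
  split_ifs <;> simp

theorem mulOp_creation_annihilation :
    mulOp creation annihilation = Matrix.diagonal (fun n : ℕ => (n : ℂ)) := by
  ext m n
  rcases m with _ | m
  · rw [mulOp_eq_single 0 fun l _ => by simp [creation_apply]]
    rcases n with _ | n
    · simp [creation_apply]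
    · simp [creation_apply]
  · rw [mulOp_eq_single m fun l hl => by simp [creation_apply, hl]]
    by_cases h : m + 1 = n
    · subst h
      rw [Matrix.diagonal_apply_eq]
      simp only [creation_apply, annihilation, if_true, sqrt_mul_sqrt_natCast]
    · rw [Matrix.diagonal_apply_ne _ h]
      simp [annihilation, h]

theorem sigmaPlus_mul_sigmaMinus :
    sigmaPlus * sigmaMinus = Matrix.diagonal (fun a : Fin 2 => ((a : ℕ) : ℂ)) := by
  ext a b
  fin_cases a <;> fin_cases b <;> simp [sigmaPlus, sigmaMinus]

theorem Params.freeHamiltonian_eq (p : Params) : p.freeHamiltonian = Matrix.diagonal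
    (fun q : Fin 2 × ℕ => p.omegaA * ((q.1 : ℕ) : ℂ) + p.omegaC * (q.2 : ℂ)) := by
  rw [Params.freeHamiltonian, sigmaPlus_mul_sigmaMinus, mulOp_creation_annihilation,
    ← Matrix.diagonal_one, ← Matrix.diagonal_one, Matrix.diagonal_kronecker_diagonal,
    Matrix.diagonal_kronecker_diagonal]
  ext i j
  by_cases h : i = j
  · subst h; simp
  · simp [h]

/-- The `(a, b)` block of an operator of the composite system. -/
def block (a b : Fin 2) : OpAB →ₗ[ℂ] OpB where
  toFun X := fun m n => X (a, m) (b, n)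
  map_add' _ _ := rfl
  map_smul' _ _ := rfl

theorem block_apply (a b : Fin 2) (X : OpAB) (m n : ℕ) : block a b X m n = X (a, m) (b, n) := rfl

theorem mulOp_annihilation_left (X : OpAB) (a : Fin 2) (m : ℕ) (j : Fin 2 × ℕ) :
    mulOp ((1 : OpA) ⊗ₖ annihilation) X (a, m) j
      = ((Real.sqrt ((m + 1 : ℕ) : ℝ) : ℝ) : ℂ) * X (a, m + 1) j := by
  rw [mulOp_eq_single (a, m + 1)]
  · simp [annihilation]
  · rintro ⟨c, k⟩ h
    by_cases hc : a = c
    · subst hc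
      have : ¬ m + 1 = k := fun e => h (by rw [e])
      simp [annihilation, this]
    · simp [hc]

theorem mulOp_annihilation_right (X : OpAB) (i : Fin 2 × ℕ) (b : Fin 2) (n : ℕ) :
    mulOp X ((1 : OpA) ⊗ₖ annihilation).conjTranspose i (b, n)
      = ((Real.sqrt ((n + 1 : ℕ) : ℝ) : ℝ) : ℂ) * X i (b, n + 1) := by
  rw [mulOp_eq_single (b, n + 1)]
  · simp [Matrix.conjTranspose_apply, annihilation, mul_comm]
  · rintro ⟨c, k⟩ h
    by_cases hc : b = c
    · subst hc
      have : ¬ n + 1 = k := fun e => h (by rw [e])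
      simp [Matrix.conjTranspose_apply, annihilation, this]
    · simp [Matrix.conjTranspose_apply, hc]

theorem mulOp_annihilation_conjTranspose_annihilation :
    mulOp ((1 : OpA) ⊗ₖ annihilation).conjTranspose ((1 : OpA) ⊗ₖ annihilation)
      = Matrix.diagonal (fun q : Fin 2 × ℕ => (q.2 : ℂ)) := by
  ext ⟨a, m⟩ ⟨b, n⟩
  have h : ∀ l, ((1 : OpA) ⊗ₖ annihilation).conjTranspose (a, m) l
      = if l.1 = a ∧ l.2 + 1 = m then ((Real.sqrt m : ℝ) : ℂ) else 0 := by
    rintro ⟨c, k⟩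
    by_cases hc : c = a <;> by_cases hk : k + 1 = m <;>
      simp [Matrix.conjTranspose_apply, annihilation, hc, hk]
  rcases m with _ | m
  · rw [mulOp_eq_single (a, 0) fun l _ => by rw [h]; simp, h]
    by_cases e : ((a, 0) : Fin 2 × ℕ) = (b, n)
    · obtain ⟨rfl, rfl⟩ := Prod.mk_inj.mp e
      simp
    · rw [Matrix.diagonal_apply_ne _ e]; simp
  · rw [mulOp_eq_single (a, m), h]
    · by_cases ha : a = b <;> by_cases hm : m + 1 = n
      · subst ha hm
        simp only [Matrix.diagonal_apply_eq, Matrix.kronecker_apply, annihilation]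
        simp only [and_self, if_true, Matrix.one_apply_eq, one_mul, sqrt_mul_sqrt_natCast]
      · rw [Matrix.diagonal_apply_ne _ fun e => hm (Prod.ext_iff.mp e).2]
        simp [annihilation, hm]
      · rw [Matrix.diagonal_apply_ne _ fun e => ha (Prod.ext_iff.mp e).1]
        simp [ha]
      · rw [Matrix.diagonal_apply_ne _ fun e => hm (Prod.ext_iff.mp e).2]
        simp [annihilation, hm]
    · rintro ⟨c, k⟩ hne
      rw [h, if_neg, zero_mul]
      rintro ⟨h1, h2⟩
      exact hne (Prod.ext h1 (Nat.succ_injective h2))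

/-! ### The free generator on coherent kernels. -/

namespace Params

variable (p : Params)

/-- The complex frequency `i ω_c + γ / 2` of the damped mode. -/
def modeRate : ℂ := Complex.I * p.omegaC + p.gamma / 2

/-- The complex conjugate `-i ω_c + γ / 2` of `modeRate`. -/
def modeRateConj : ℂ := -(Complex.I * p.omegaC) + p.gamma / 2

/-- The generator of the damped mode. -/
def modeGen : Module.End ℂ OpB :=
  -(p.modeRate • (dLeft * leftLower)) - p.modeRateConj • (dRight * rightLower)

/-- The jump term `bXb†` is shared between `[b†, bX]` and `[Xb†, b]`, whose weights `κ` and `κ̄` add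
up to `γ`; the atomic Hamiltonian only contributes a scalar on each block. -/
theorem freeGen_block (X : OpAB) (a b : Fin 2) : block a b (p.freeGen X) =
    (-(Complex.I * p.omegaA * (((a : ℕ) : ℂ) - ((b : ℕ) : ℂ)))) • block a b X
      + p.modeGen (block a b X) := by
  ext m n
  have h1 : leftRaise (leftLower (block a b X)) m n = (m : ℂ) * X (a, m) (b, n) := by
    rcases m with _ | m
    · simp [leftRaise_apply]
    · simp only [leftRaise_apply, leftLower_apply, Nat.add_sub_cancel, ← mul_assoc,
        sqrt_mul_sqrt_natCast, block_apply]
  have h2 : rightRaise (rightLower (block a b X)) m n = (n : ℂ) * X (a, m) (b, n) := by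
    rcases n with _ | n
    · simp [rightRaise_apply]
    · simp only [rightRaise_apply, rightLower_apply, Nat.add_sub_cancel, ← mul_assoc,
        sqrt_mul_sqrt_natCast, block_apply]
  have h3 : rightLower (leftLower (block a b X)) m n = leftLower (rightLower (block a b X)) m n :=
    congrFun (congrFun (LinearMap.congr_fun commute_leftLower_rightLower.eq.symm _) m) n
  have h4 : leftLower (rightLower (block a b X)) m n
      = ((Real.sqrt ((n + 1 : ℕ) : ℝ) : ℝ) : ℂ) *
        (((Real.sqrt ((m + 1 : ℕ) : ℝ) : ℝ) : ℂ) * X (a, m + 1) (b, n + 1)) := by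
    simp only [leftLower_apply, rightLower_apply, block_apply]; ring
  simp only [block_apply, freeGen, commOp, dissipator, freeHamiltonian_eq, Matrix.add_apply,
    Matrix.sub_apply, Matrix.smul_apply, mulOp_diagonal_left, mulOp_diagonal_right,
    mulOp_annihilation_conjTranspose_annihilation, mulOp_annihilation_right,
    mulOp_annihilation_left, smul_eq_mul, modeGen, LinearMap.sub_apply, LinearMap.neg_apply,
    LinearMap.smul_apply, Matrix.neg_apply, Module.End.mul_apply, dLeft, dRight, h1, h2, h3, h4,
    modeRate, modeRateConj]
  ring

/-- This is `∂ᵤʲ∂ᵥᵏ` applied to `-κu∂ᵤK - κ̄v∂ᵥK`. The last two terms transport the base point, the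
first one damps the coefficient. -/
theorem modeGen_kernelDeriv (u v : ℂ) (j k : ℕ) : p.modeGen (kernelDeriv u v j k) =
    (-(p.modeRate * j + p.modeRateConj * k)) • kernelDeriv u v j k
      + ((-p.modeRate * u) • kernelDeriv u v (j + 1) k
        + (-p.modeRateConj * v) • kernelDeriv u v j (k + 1)) := by
  have h1 : (j : ℂ) • kernelDeriv u v (j - 1 + 1) k = (j : ℂ) • kernelDeriv u v j k := by
    rcases j with _ | j
    · simp
    · rfl
  have h2 : (k : ℂ) • kernelDeriv u v j (k - 1 + 1) = (k : ℂ) • kernelDeriv u v j k := by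
    rcases k with _ | k
    · simp
    · rfl
  simp only [modeGen, LinearMap.sub_apply, LinearMap.neg_apply, LinearMap.smul_apply,
    Module.End.mul_apply, leftLower_kernelDeriv, rightLower_kernelDeriv, map_add, map_smul,
    dLeft_kernelDeriv, dRight_kernelDeriv, h1, h2]
  module

/-! ### The exponential series of the free generator -/

theorem freeGen_hasDerivAt {Y : ℂ → OpAB} {Y' : OpAB} {t : ℂ}
    (h : ∀ i j, HasDerivAt (fun s => Y s i j) (Y' i j) t) (i j : Fin 2 × ℕ) :
    HasDerivAt (fun s => p.freeGen (Y s) i j) (p.freeGen Y' i j) t := by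
  obtain ⟨a, m⟩ := i
  obtain ⟨b, n⟩ := j
  have hL : ∀ Z : OpAB, p.freeGen Z (a, m) (b, n) = block a b (p.freeGen Z) m n := fun _ => rfl
  have hl : HasEntryDeriv (fun s => leftLower (block a b (Y s))) (leftLower (block a b Y')) t :=
    fun m n => (h (a, m + 1) (b, n)).const_mul _
  have hr : HasEntryDeriv (fun s => rightLower (block a b (Y s))) (rightLower (block a b Y')) t :=
    fun m n => (h (a, m) (b, n + 1)).const_mul _
  simp only [hL, freeGen_block]
  exact ((h (a, m) (b, n)).const_mul _).add
    (((hl.dLeft m n).const_mul _).neg.sub ((hr.dRight m n).const_mul _))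

/-- An entrywise solution of `Y' = 𝓛₀Y` in complex time has entire entries, whose `n`-th derivatives
are the entries of `𝓛₀ⁿY`. The exponential series is thus a Taylor series, and no bound on `𝓛₀` is
needed. -/
theorem hasSum_expTerm {Y : ℂ → OpAB}
    (h : ∀ t i j, HasDerivAt (fun s => Y s i j) (p.freeGen (Y t) i j) t) (t₀ : ℂ) (t : ℝ)
    (i j : Fin 2 × ℕ) : HasSum (fun n => p.expTerm t (Y t₀) n i j) (Y (t₀ + t) i j) := by
  have key : ∀ (n : ℕ) (t : ℂ),
      HasDerivAt (fun s => p.freeGen^[n] (Y s) i j) (p.freeGen^[n + 1] (Y t) i j) t := by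
    have aux : ∀ (n : ℕ) (t : ℂ) (i j : Fin 2 × ℕ),
        HasDerivAt (fun s => p.freeGen^[n] (Y s) i j) (p.freeGen^[n + 1] (Y t) i j) t := by
      intro n
      induction n with
      | zero => exact fun t i j => h t i j
      | succ n ih =>
        intro t i j
        simp only [Function.iterate_succ_apply'] at ih ⊢
        exact p.freeGen_hasDerivAt (ih t) i j
    exact fun n t => aux n t i j
  have hiter : ∀ n : ℕ, iteratedDeriv n (fun s => Y s i j) = fun s => p.freeGen^[n] (Y s) i j := by
    intro n
    induction n with
    | zero => simp
    | succ n ih =>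
      rw [iteratedDeriv_succ, ih]
      exact funext fun s => (key n s).deriv
  have hd : Differentiable ℂ (fun s => Y s i j) := fun s => (h s i j).differentiableAt
  have hs := Complex.hasSum_taylorSeries_of_entire hd t₀ (t₀ + t)
  simp only [hiter, add_sub_cancel_left] at hs
  refine (?_ : _ = fun n => p.expTerm t (Y t₀) n i j) ▸ hs
  funext n
  simp only [expTerm, Matrix.smul_apply, smul_eq_mul]
  push_cast
  ring

/-! ### The interaction generator, block by block -/

theorem mulOp_interaction_left_zero (X : OpAB) (m : ℕ) (j : Fin 2 × ℕ) :
    mulOp p.interactionHamiltonian X (0, m) j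
      = star p.g * (((Real.sqrt (m : ℝ) : ℝ) : ℂ) * X (1, m - 1) j) := by
  rw [mulOp_eq_single (1, m - 1)]
  · rcases m with _ | m <;> simp [interactionHamiltonian, sigmaPlus, sigmaMinus, creation_apply]
    ring
  · rintro ⟨c, k⟩ h
    fin_cases c
    · simp [interactionHamiltonian, sigmaPlus, sigmaMinus]
    · have : ¬ k + 1 = m := fun e => h (by simp [← e])
      simp [interactionHamiltonian, sigmaPlus, sigmaMinus, creation_apply, this]

theorem mulOp_interaction_left_one (X : OpAB) (m : ℕ) (j : Fin 2 × ℕ) :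
    mulOp p.interactionHamiltonian X (1, m) j
      = p.g * (((Real.sqrt ((m + 1 : ℕ) : ℝ) : ℝ) : ℂ) * X (0, m + 1) j) := by
  rw [mulOp_eq_single (0, m + 1)]
  · simp [interactionHamiltonian, sigmaPlus, sigmaMinus, annihilation]
    ring
  · rintro ⟨c, k⟩ h
    fin_cases c
    · have : ¬ m + 1 = k := fun e => h (by simp [← e])
      simp [interactionHamiltonian, sigmaPlus, sigmaMinus, annihilation, this]
    · simp [interactionHamiltonian, sigmaPlus, sigmaMinus]

theorem mulOp_interaction_right_zero (X : OpAB) (i : Fin 2 × ℕ) (n : ℕ) :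
    mulOp X p.interactionHamiltonian i (0, n)
      = p.g * (((Real.sqrt (n : ℝ) : ℝ) : ℂ) * X i (1, n - 1)) := by
  rw [mulOp_eq_single (1, n - 1)]
  · rcases n with _ | n <;> simp [interactionHamiltonian, sigmaPlus, sigmaMinus, annihilation]
    ring
  · rintro ⟨c, k⟩ h
    fin_cases c
    · simp [interactionHamiltonian, sigmaPlus, sigmaMinus]
    · have : ¬ k + 1 = n := fun e => h (by simp [← e])
      simp [interactionHamiltonian, sigmaPlus, sigmaMinus, annihilation, this]

theorem mulOp_interaction_right_one (X : OpAB) (i : Fin 2 × ℕ) (n : ℕ) :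
    mulOp X p.interactionHamiltonian i (1, n)
      = star p.g * (((Real.sqrt ((n + 1 : ℕ) : ℝ) : ℝ) : ℂ) * X i (0, n + 1)) := by
  rw [mulOp_eq_single (0, n + 1)]
  · simp [interactionHamiltonian, sigmaPlus, sigmaMinus, creation_apply]
    ring
  · rintro ⟨c, k⟩ h
    fin_cases c
    · have : ¬ n + 1 = k := fun e => h (by simp [← e])
      simp [interactionHamiltonian, sigmaPlus, sigmaMinus, creation_apply, this]
    · simp [interactionHamiltonian, sigmaPlus, sigmaMinus]

theorem intGen_block_zero_zero (X : OpAB) : block 0 0 (p.intGen X) =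
    (-Complex.I * star p.g) • leftRaise (block 1 0 X)
      + (Complex.I * p.g) • rightRaise (block 0 1 X) := by
  ext m n
  simp only [block_apply, intGen, commOp, Matrix.smul_apply, Matrix.sub_apply, Matrix.add_apply,
    mulOp_interaction_left_zero, mulOp_interaction_right_zero, smul_eq_mul, leftRaise_apply,
    rightRaise_apply]
  ring

theorem intGen_block_zero_one (X : OpAB) : block 0 1 (p.intGen X) =
    (-Complex.I * star p.g) • leftRaise (block 1 1 X)
      + (Complex.I * star p.g) • rightLower (block 0 0 X) := by
  ext m n
  simp only [block_apply, intGen, commOp, Matrix.smul_apply, Matrix.sub_apply, Matrix.add_apply,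
    mulOp_interaction_left_zero, mulOp_interaction_right_one, smul_eq_mul, leftRaise_apply,
    rightLower_apply]
  ring

theorem intGen_block_one_zero (X : OpAB) : block 1 0 (p.intGen X) =
    (-Complex.I * p.g) • leftLower (block 0 0 X)
      + (Complex.I * p.g) • rightRaise (block 1 1 X) := by
  ext m n
  simp only [block_apply, intGen, commOp, Matrix.smul_apply, Matrix.sub_apply, Matrix.add_apply,
    mulOp_interaction_left_one, mulOp_interaction_right_zero, smul_eq_mul, leftLower_apply,
    rightRaise_apply]
  ring

theorem intGen_block_one_one (X : OpAB) : block 1 1 (p.intGen X) =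
    (-Complex.I * p.g) • leftLower (block 0 1 X)
      + (Complex.I * star p.g) • rightLower (block 1 0 X) := by
  ext m n
  simp only [block_apply, intGen, commOp, Matrix.smul_apply, Matrix.sub_apply, Matrix.add_apply,
    mulOp_interaction_left_one, mulOp_interaction_right_one, smul_eq_mul, leftLower_apply,
    rightLower_apply]
  ring

theorem eq_of_block_eq {X Y : OpAB} (h00 : block 0 0 X = block 0 0 Y)
    (h01 : block 0 1 X = block 0 1 Y) (h10 : block 1 0 X = block 1 0 Y)
    (h11 : block 1 1 X = block 1 1 Y) : X = Y := by
  ext ⟨a, m⟩ ⟨b, n⟩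
  fin_cases a <;> fin_cases b
  · exact congrFun (congrFun h00 m) n
  · exact congrFun (congrFun h01 m) n
  · exact congrFun (congrFun h10 m) n
  · exact congrFun (congrFun h11 m) n

theorem intGen_add (X Y : OpAB) : p.intGen (X + Y) = p.intGen X + p.intGen Y := by
  apply eq_of_block_eq <;>
  simp only [map_add, intGen_block_zero_zero, intGen_block_zero_one, intGen_block_one_zero,
    intGen_block_one_one, smul_add] <;> abel

theorem intGen_zero : p.intGen 0 = 0 := by
  apply eq_of_block_eq <;>
  simp only [map_zero, intGen_block_zero_zero, intGen_block_zero_one, intGen_block_one_zero,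
    intGen_block_one_one, smul_zero, add_zero]

theorem freeGen_add (X Y : OpAB) : p.freeGen (X + Y) = p.freeGen X + p.freeGen Y := by
  apply eq_of_block_eq <;> simp only [map_add, freeGen_block, smul_add] <;> abel

theorem freeGen_zero : p.freeGen 0 = 0 := by
  apply eq_of_block_eq <;> simp only [map_zero, freeGen_block, smul_zero, add_zero]

/-! ### States spanned by derivatives of coherent kernels -/

/-- The phase acquired by the `(a, b)` entry under the free evolution of the atom. -/
def atomPhase (t : ℂ) (a b : Fin 2) : ℂ :=
  Complex.exp (-(Complex.I * p.omegaA * (((a : ℕ) : ℂ) - ((b : ℕ) : ℂ))) * t)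

/-- The time dependence of the component with matrix indices `(a, b)` and derivative order `q`. -/
def weight (t : ℂ) (a b : Fin 2) (q : ℕ × ℕ) : ℂ :=
  p.atomPhase t a b * Complex.exp (-p.modeRate * t) ^ q.1 * Complex.exp (-p.modeRateConj * t) ^ q.2

/-- The free evolution of `∑ q, x q ⊗ ∂^q |z⟩⟨z|`. -/
def evolved (x : ℕ × ℕ →₀ OpA) (t : ℂ) : OpAB := fun i j =>
  x.sum fun q ρ => p.weight t i.1 j.1 q * ρ i.1 j.1 *
    kernelDeriv (p.z * Complex.exp (-p.modeRate * t)) (star p.z * Complex.exp (-p.modeRateConj * t))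
      q.1 q.2 i.2 j.2

theorem evolved_zero (t : ℂ) : p.evolved 0 t = 0 := by
  ext i j; simp [evolved]

theorem evolved_add (x y : ℕ × ℕ →₀ OpA) (t : ℂ) :
    p.evolved (x + y) t = p.evolved x t + p.evolved y t := by
  ext i j
  simp only [evolved, Matrix.add_apply]
  exact Finsupp.sum_add_index' (by simp) (by simp; intros; ring)

theorem evolved_single (q : ℕ × ℕ) (ρ : OpA) (t : ℂ) (a b : Fin 2) :
    block a b (p.evolved (Finsupp.single q ρ) t) = (p.weight t a b q * ρ a b) •
      kernelDeriv (p.z * Complex.exp (-p.modeRate * t))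
        (star p.z * Complex.exp (-p.modeRateConj * t)) q.1 q.2 := by
  ext m n
  simp only [block_apply, evolved, Matrix.smul_apply, smul_eq_mul]
  rw [Finsupp.sum_single_index (by simp)]

/-- The factor `e^{-|z|²}` of the kernel at `(z, z̄)` splits evenly between the two coherent
vectors. Treating `u` and `v` as independent elsewhere is what keeps the evolution holomorphic in
`t`. -/
theorem evolved_initial (ρ : OpA) :
    p.evolved (Finsupp.single (0, 0) ρ) 0 = ρ ⊗ₖ coherentState p.z := by
  ext ⟨a, m⟩ ⟨b, n⟩
  have h := congrFun (congrFun (p.evolved_single (0, 0) ρ 0 a b) m) n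
  rw [block_apply] at h
  rw [h]
  have h1 : Complex.exp (-(p.z * star p.z))
      = ((Real.exp (-‖p.z‖ ^ 2 / 2) : ℝ) : ℂ) * ((Real.exp (-‖p.z‖ ^ 2 / 2) : ℝ) : ℂ) := by
    rw [← Complex.ofReal_mul, ← Real.exp_add, Complex.star_def, Complex.mul_conj,
      Complex.normSq_eq_norm_sq]
    push_cast
    congr 1; ring
  rw [Complex.star_def] at h1
  simp only [weight, atomPhase, mul_zero, Complex.exp_zero, kernelDeriv, coherentKernel, pow_zero,
    mul_one, one_mul, Matrix.smul_apply, smul_eq_mul, Module.End.one_apply,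
    Matrix.kronecker_apply, coherentState, coherentVec, h1, star_div₀, star_mul', star_pow,
    Complex.star_def, Complex.conj_ofReal]
  ring

theorem hasDerivAt_weight (t : ℂ) (a b : Fin 2) (q : ℕ × ℕ) :
    HasDerivAt (fun s => p.weight s a b q)
      ((-(Complex.I * p.omegaA * (((a : ℕ) : ℂ) - ((b : ℕ) : ℂ)))
        - (p.modeRate * q.1 + p.modeRateConj * q.2)) * p.weight t a b q) t := by
  have h : ∀ s, p.weight s a b q = Complex.exp ((-(Complex.I * p.omegaA *
      (((a : ℕ) : ℂ) - ((b : ℕ) : ℂ))) - (p.modeRate * q.1 + p.modeRateConj * q.2)) * s) := by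
    intro s
    simp only [weight, atomPhase, ← Complex.exp_nat_mul, ← Complex.exp_add]
    congr 1; ring
  simp only [h]
  exact (((hasDerivAt_id t).const_mul _).cexp).congr_deriv (by simp; ring)

/-- Method of characteristics: the moving base point produces the transport terms of
`modeGen_kernelDeriv`, and the derivative of the weight produces the scalar terms. -/
theorem hasDerivAt_evolved (x : ℕ × ℕ →₀ OpA) (t : ℂ) (i j : Fin 2 × ℕ) :
    HasDerivAt (fun s => p.evolved x s i j) (p.freeGen (p.evolved x t) i j) t := by
  induction x using Finsupp.induction_linear with
  | zero =>
    simp only [evolved_zero, freeGen_zero]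
    exact hasDerivAt_const t _
  | add x y hx hy =>
    simp only [evolved_add, freeGen_add]
    exact hx.add hy
  | single q ρ =>
    obtain ⟨a, m⟩ := i
    obtain ⟨b, n⟩ := j
    have hL : ∀ Z : OpAB, Z (a, m) (b, n) = block a b Z m n := fun _ => rfl
    simp only [hL, freeGen_block, evolved_single, map_smul, modeGen_kernelDeriv]
    have h1 : HasDerivAt (fun s => p.z * Complex.exp (-p.modeRate * s))
        (-p.modeRate * (p.z * Complex.exp (-p.modeRate * t))) t :=
      ((((hasDerivAt_id t).const_mul _).cexp).const_mul p.z).congr_deriv (by simp; ring)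
    have h2 : HasDerivAt (fun s => star p.z * Complex.exp (-p.modeRateConj * s))
        (-p.modeRateConj * (star p.z * Complex.exp (-p.modeRateConj * t))) t :=
      ((((hasDerivAt_id t).const_mul _).cexp).const_mul (star p.z)).congr_deriv (by simp; ring)
    refine (((p.hasDerivAt_weight t a b q).mul_const (ρ a b)).mul
      (hasEntryDeriv_kernelDeriv h1 h2 q.1 q.2 m n)).congr_deriv ?_
    simp only [Matrix.add_apply, Matrix.smul_apply, smul_eq_mul]
    ring

theorem hasSum_expTerm_evolved (x : ℕ × ℕ →₀ OpA) (s : ℂ) (t : ℝ) (i j : Fin 2 × ℕ) :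
    HasSum (fun n => p.expTerm t (p.evolved x s) n i j) (p.evolved x (s + t) i j) :=
  p.hasSum_expTerm (p.hasDerivAt_evolved x) s t i j

theorem expFree_evolved (x : ℕ × ℕ →₀ OpA) (s : ℂ) (t : ℝ) :
    p.expFree t (p.evolved x s) = p.evolved x (s + t) := by
  ext i j
  exact (p.hasSum_expTerm_evolved x s t i j).tsum_eq

theorem hasSum_trace_evolved (x : ℕ × ℕ →₀ OpA) (t : ℂ) (a b : Fin 2) :
    HasSum (fun n => p.evolved x t (a, n) (b, n)) (p.atomPhase t a b * x (0, 0) a b) := by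
  induction x using Finsupp.induction_linear with
  | zero => simpa only [evolved_zero, Finsupp.zero_apply, Matrix.zero_apply, mul_zero]
      using hasSum_zero
  | add x y hx hy =>
    simpa only [evolved_add, Finsupp.add_apply, Matrix.add_apply, mul_add] using hx.add hy
  | single q ρ =>
    have hL : ∀ n, p.evolved (Finsupp.single q ρ) t (a, n) (b, n)
        = block a b (p.evolved (Finsupp.single q ρ) t) n n := fun _ => rfl
    simp only [hL, evolved_single, Matrix.smul_apply, smul_eq_mul]
    have h := (hasSum_diag_kernelDeriv (p.z * Complex.exp (-p.modeRate * t))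
        (star p.z * Complex.exp (-p.modeRateConj * t)) q.1 q.2).mul_left
          (p.weight t a b q * ρ a b)
    obtain ⟨j, k⟩ := q
    by_cases hq : j = 0 ∧ k = 0
    · obtain ⟨rfl, rfl⟩ := hq
      simpa [weight] using h
    · have : ((j, k) : ℕ × ℕ) ≠ (0, 0) := fun e => hq (Prod.mk_inj.mp e)
      rw [Finsupp.single_eq_of_ne' this]
      simpa [hq] using h

/-! ### The interaction generator on coefficients -/

/-- The factor `e^{-Γ t}`. -/
def decay (t : ℂ) : ℂ := Complex.exp (-p.Gam * t)

/-- The factor `e^{-Γ̄ t}`. -/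
def decayConj (t : ℂ) : ℂ := Complex.exp (-star p.Gam * t)

/-- The superoperator `-i g [σ⁺, ·]`. -/
def raiseComm : OpA →ₗ[ℂ] OpA :=
  (-Complex.I * p.g) • (LinearMap.mulLeft ℂ sigmaPlus - LinearMap.mulRight ℂ sigmaPlus)

/-- The superoperator `-i ḡ [σ⁻, ·]`. -/
def lowerComm : OpA →ₗ[ℂ] OpA :=
  (-Complex.I * star p.g) • (LinearMap.mulLeft ℂ sigmaMinus - LinearMap.mulRight ℂ sigmaMinus)

/-- The superoperator `-i ḡ σ⁻ ·`. -/
def lowerLeft : OpA →ₗ[ℂ] OpA :=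
  (-Complex.I * star p.g) • LinearMap.mulLeft ℂ sigmaMinus

/-- The superoperator `i g · σ⁺`. -/
def raiseRight : OpA →ₗ[ℂ] OpA :=
  (Complex.I * p.g) • LinearMap.mulRight ℂ sigmaPlus

/-- The action of `𝓛(t)` on the coefficients of a state. -/
def intCoeff (t : ℂ) (x : ℕ × ℕ →₀ OpA) : ℕ × ℕ →₀ OpA :=
  x.sum fun q ρ =>
    Finsupp.single q ((p.z * p.decay t) • p.raiseComm ρ
      + (star p.z * p.decayConj t) • p.lowerComm ρ)
    + Finsupp.single (q.1 - 1, q.2) (((q.1 : ℂ) * p.decay t) • p.raiseComm ρ)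
    + Finsupp.single (q.1, q.2 - 1) (((q.2 : ℂ) * p.decayConj t) • p.lowerComm ρ)
    + Finsupp.single (q.1 + 1, q.2) ((p.decay t)⁻¹ • p.lowerLeft ρ)
    + Finsupp.single (q.1, q.2 + 1) ((p.decayConj t)⁻¹ • p.raiseRight ρ)

theorem intCoeff_zero (t : ℂ) : p.intCoeff t 0 = 0 := by simp [intCoeff]

theorem intCoeff_single (t : ℂ) (q : ℕ × ℕ) (ρ : OpA) : p.intCoeff t (Finsupp.single q ρ) =
    Finsupp.single q ((p.z * p.decay t) • p.raiseComm ρ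
      + (star p.z * p.decayConj t) • p.lowerComm ρ)
    + Finsupp.single (q.1 - 1, q.2) (((q.1 : ℂ) * p.decay t) • p.raiseComm ρ)
    + Finsupp.single (q.1, q.2 - 1) (((q.2 : ℂ) * p.decayConj t) • p.lowerComm ρ)
    + Finsupp.single (q.1 + 1, q.2) ((p.decay t)⁻¹ • p.lowerLeft ρ)
    + Finsupp.single (q.1, q.2 + 1) ((p.decayConj t)⁻¹ • p.raiseRight ρ) := by
  rw [intCoeff, Finsupp.sum_single_index (by simp)]

theorem intCoeff_add (t : ℂ) (x y : ℕ × ℕ →₀ OpA) :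
    p.intCoeff t (x + y) = p.intCoeff t x + p.intCoeff t y := by
  refine Finsupp.sum_add_index' (by simp) fun q ρ₁ ρ₂ => ?_
  simp only [map_add, smul_add, Finsupp.single_add]
  abel

/-- The same map read at its target: what reaches `(i, j)` from itself and its four neighbours. This
is the shape of `hierarchyRhs`. -/
theorem intCoeff_apply (t : ℂ) (x : ℕ × ℕ →₀ OpA) (i j : ℕ) : p.intCoeff t x (i, j) =
    (p.z * p.decay t) • p.raiseComm (x (i, j))
      + (star p.z * p.decayConj t) • p.lowerComm (x (i, j))
    + (((i + 1 : ℕ) : ℂ) * p.decay t) • p.raiseComm (x (i + 1, j))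
    + (((j + 1 : ℕ) : ℂ) * p.decayConj t) • p.lowerComm (x (i, j + 1))
    + (if i = 0 then 0 else (p.decay t)⁻¹ • p.lowerLeft (x (i - 1, j)))
    + (if j = 0 then 0 else (p.decayConj t)⁻¹ • p.raiseRight (x (i, j - 1))) := by
  induction x using Finsupp.induction_linear with
  | zero => simp [intCoeff_zero]
  | add x y hx hy =>
    simp only [intCoeff_add, Finsupp.add_apply, map_add, smul_add, hx, hy]
    split_ifs <;> abel
  | single q ρ =>
    obtain ⟨k, l⟩ := q
    rw [intCoeff_single]
    simp only [Finsupp.add_apply, Finsupp.single_apply, Prod.mk_inj]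
    congr 1
    · congr 1
      · congr 1
        · congr 1
          · split_ifs <;> simp
          -- A source of order `0` would be sent by truncation to order `0`, but its factor is `0`.
          · rcases k with _ | k
            · simp
            · by_cases h : k = i ∧ l = j <;> simp [h]
        · rcases l with _ | l
          · simp
          · by_cases h : k = i ∧ l = j <;> simp [h]
      · rcases i with _ | i
        · simp
        · by_cases h : k = i ∧ l = j <;> simp [h]
    · rcases j with _ | j
      · simp
      · by_cases h : k = i ∧ l = j <;> simp [h]

theorem decay_ne_zero (t : ℂ) : p.decay t ≠ 0 := Complex.exp_ne_zero _

theorem decayConj_ne_zero (t : ℂ) : p.decayConj t ≠ 0 := Complex.exp_ne_zero _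

theorem star_Gam : star p.Gam = p.modeRateConj + Complex.I * p.omegaA := by
  simp only [Gam, modeRateConj, Complex.star_def, map_add, map_mul, map_neg, Complex.conj_I,
    Complex.conj_ofReal, map_div₀, map_ofNat]
  push_cast; ring

theorem exp_modeRate (t : ℂ) : Complex.exp (-p.modeRate * t)
    = p.decay t * Complex.exp (-(Complex.I * p.omegaA) * t) := by
  rw [decay, ← Complex.exp_add, Gam, modeRate]
  congr 1; push_cast; ring

theorem exp_modeRateConj (t : ℂ) : Complex.exp (-p.modeRateConj * t)
    = p.decayConj t * (Complex.exp (-(Complex.I * p.omegaA) * t))⁻¹ := by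
  rw [decayConj, ← Complex.exp_neg, ← Complex.exp_add, star_Gam]
  congr 1; ring

/-- The terms `u∂ʲK` common to `bX` and `Xb` assemble into `[σ⁺,·]`, while the extra `∂ᵥ` of `Xb`
leaves the one-sided `·σ⁺`; likewise for `b†` and `σ⁻`. Atomic and mode phases combine through `κ =
Γ + iω_A`. -/
theorem intGen_evolved (x : ℕ × ℕ →₀ OpA) (t : ℂ) :
    p.intGen (p.evolved x t) = p.evolved (p.intCoeff t x) t := by
  induction x using Finsupp.induction_linear with
  | zero => simp only [evolved_zero, intGen_zero, intCoeff_zero]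
  | add x y hx hy => simp only [evolved_add, intGen_add, intCoeff_add, hx, hy]
  | single q ρ =>
    obtain ⟨j, k⟩ := q
    have h00 : p.atomPhase t 0 0 = 1 := by simp [atomPhase]
    have h11 : p.atomPhase t 1 1 = 1 := by simp [atomPhase]
    have h10 : p.atomPhase t 1 0 = Complex.exp (-(Complex.I * p.omegaA) * t) := by simp [atomPhase]
    have h01 : p.atomPhase t 0 1 = (Complex.exp (-(Complex.I * p.omegaA) * t))⁻¹ := by
      rw [← Complex.exp_neg]; simp [atomPhase]
    have ha := p.decay_ne_zero t
    have hb := p.decayConj_ne_zero t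
    have he := Complex.exp_ne_zero (-(Complex.I * p.omegaA) * t)
    have hm := p.exp_modeRate t
    have hn := p.exp_modeRateConj t
    rw [intCoeff_single]
    apply eq_of_block_eq <;>
    simp only [evolved_add, map_add, intGen_block_zero_zero, intGen_block_zero_one,
      intGen_block_one_zero, intGen_block_one_one, evolved_single, map_smul,
      leftLower_kernelDeriv, rightLower_kernelDeriv, leftRaise_kernelDeriv,
      rightRaise_kernelDeriv] <;>
    ext m n <;>
    simp only [Matrix.add_apply, Matrix.smul_apply, smul_eq_mul] <;>
    simp only [weight, h00, h11, h10, h01, hm, hn, raiseComm, lowerComm,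
      lowerLeft, raiseRight, LinearMap.smul_apply,
      LinearMap.sub_apply, LinearMap.mulLeft_apply, LinearMap.mulRight_apply, Matrix.smul_apply,
      Matrix.sub_apply, Matrix.mul_apply, Fin.sum_univ_two, sigmaPlus, sigmaMinus, Matrix.of_apply,
      Matrix.cons_val', Matrix.cons_val_zero, Matrix.cons_val_one, Matrix.cons_val_fin_one,
      smul_eq_mul, mul_zero, zero_mul, add_zero, zero_add, mul_one, one_mul, sub_zero, zero_sub,
      sub_self] <;>
    generalize p.decay t = a at ha ⊢ <;> generalize p.decayConj t = b at hb ⊢ <;>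
    generalize Complex.exp (-(Complex.I * p.omegaA) * t) = e at he ⊢ <;>
    rcases j with _ | j <;> rcases k with _ | k <;>
    simp only [Nat.cast_zero, zero_mul, mul_zero, add_zero, pow_succ, pow_zero,
      Nat.add_sub_cancel] <;>
    field_simp <;> ring

end Params

/-! ### Ordered integrals -/

/-- The ordered integral of `F` exists and has the value `v`. -/
def HasOrderedIntegral (k : ℕ) (t : ℝ) (F : List ℝ → ℂ) (v : ℂ) : Prop :=
  OrderedIntegrable k t F ∧ orderedIntegral k t F = v

theorem HasOrderedIntegral.succ {k : ℕ} {t : ℝ} {F : List ℝ → ℂ} {f : ℝ → ℂ}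
    (h : ∀ s ∈ Set.uIcc 0 t, HasOrderedIntegral k s (fun l => F (s :: l)) (f s))
    (hf : IntervalIntegrable f volume 0 t) :
    HasOrderedIntegral (k + 1) t F (∫ s in (0 : ℝ)..t, f s) := by
  refine ⟨⟨hf.congr fun s hs => ?_, fun s hs => (h s hs).1⟩, ?_⟩
  · exact (h s (Set.uIoc_subset_uIcc hs)).2.symm
  · exact intervalIntegral.integral_congr fun s hs => (h s hs).2

theorem hasOrderedIntegral_zero (k : ℕ) (t : ℝ) : HasOrderedIntegral k t (fun _ => 0) 0 := by
  induction k generalizing t with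
  | zero => exact ⟨trivial, rfl⟩
  | succ k ih =>
    have h := HasOrderedIntegral.succ (k := k) (t := t) (F := fun _ => 0) (f := fun _ => 0)
      (fun s _ => ih s) intervalIntegrable_const
    rwa [intervalIntegral.integral_zero] at h

theorem HasOrderedIntegral.add {k : ℕ} {t : ℝ} {F G : List ℝ → ℂ} {v w : ℂ}
    (hF : HasOrderedIntegral k t F v) (hG : HasOrderedIntegral k t G w) :
    HasOrderedIntegral k t (fun l => F l + G l) (v + w) := by
  induction k generalizing t F G v w with
  | zero => exact ⟨trivial, congrArg₂ (· + ·) hF.2 hG.2⟩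
  | succ k ih =>
    obtain ⟨⟨hF1, hF2⟩, rfl⟩ := hF
    obtain ⟨⟨hG1, hG2⟩, rfl⟩ := hG
    have h := HasOrderedIntegral.succ (F := fun l => F l + G l)
      (fun s hs => ih ⟨hF2 s hs, rfl⟩ ⟨hG2 s hs, rfl⟩) (hF1.add hG1)
    rwa [intervalIntegral.integral_add hF1 hG1] at h

/-! ### The hierarchy of coefficient equations -/

section Hierarchy

variable {E : Type*} [NormedRing E] [NormedAlgebra ℂ E]

/-- The right-hand side of the coefficient equations, in a normed algebra. -/
def hierarchyRhs (A B C D : E) (z₁ z₂ a b : ℂ) (c : ℕ → ℕ → E) (i j : ℕ) : E :=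
  (z₁ * a) • (A * c i j) + (z₂ * b) • (B * c i j)
    + (((i + 1 : ℕ) : ℂ) * a) • (A * c (i + 1) j) + (((j + 1 : ℕ) : ℂ) * b) • (B * c i (j + 1))
    + (if i = 0 then 0 else a⁻¹ • (C * c (i - 1) j))
    + (if j = 0 then 0 else b⁻¹ • (D * c i (j - 1)))

theorem continuous_hierarchyRhs (A B C D : E) (z₁ z₂ : ℂ) {a b : ℝ → ℂ} {c : ℕ → ℕ → ℝ → E}
    (ha : Continuous a) (hb : Continuous b) (ha0 : ∀ t, a t ≠ 0) (hb0 : ∀ t, b t ≠ 0)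
    (hc : ∀ i j, Continuous (c i j)) (i j : ℕ) :
    Continuous (fun t => hierarchyRhs A B C D z₁ z₂ (a t) (b t) (fun i j => c i j t) i j) := by
  have ha' := ha.inv₀ ha0
  have hb' := hb.inv₀ hb0
  unfold hierarchyRhs
  refine ((((((continuous_const.mul ha).smul (continuous_const.mul (hc i j))).add
    ((continuous_const.mul hb).smul (continuous_const.mul (hc i j)))).add
    ((continuous_const.mul ha).smul (continuous_const.mul (hc (i + 1) j)))).add
    ((continuous_const.mul hb).smul (continuous_const.mul (hc i (j + 1))))).add ?_).add ?_
  · split_ifs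
    · exact continuous_const
    · exact ha'.smul (continuous_const.mul (hc (i - 1) j))
  · split_ifs
    · exact continuous_const
    · exact hb'.smul (continuous_const.mul (hc i (j - 1)))

end Hierarchy

/-! ### Superoperators of the two-level system -/

/-- The normed space underlying `OpA`. -/
abbrev AtomSpace := Fin 2 → Fin 2 → ℂ

/-- The normed algebra of superoperators of the two-level system. -/
abbrev SuperOp := AtomSpace →L[ℂ] AtomSpace

/-- A linear map on `OpA`, as an element of the normed algebra of superoperators. -/
def toSuperOp (T : OpA →ₗ[ℂ] OpA) : SuperOp :=
  LinearMap.toContinuousLinearMap (show AtomSpace →ₗ[ℂ] AtomSpace from T)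

/-- The action of a superoperator on `OpA`. -/
def act (S : SuperOp) : OpA →ₗ[ℂ] OpA := show AtomSpace →ₗ[ℂ] AtomSpace from S.toLinearMap

theorem act_toSuperOp (T : OpA →ₗ[ℂ] OpA) : act (toSuperOp T) = T := rfl

theorem act_mul (S T : SuperOp) (X : OpA) : act (S * T) X = act S (act T X) := rfl

theorem act_one (X : OpA) : act 1 X = X := rfl

theorem act_zero (X : OpA) : act 0 X = 0 := rfl

theorem act_add (S T : SuperOp) (X : OpA) : act (S + T) X = act S X + act T X := rfl

theorem act_sub (S T : SuperOp) (X : OpA) : act (S - T) X = act S X - act T X := rfl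

theorem act_smul (c : ℂ) (S : SuperOp) (X : OpA) : act (c • S) X = c • act S X := rfl

/-- The evaluation `S ↦ φ (S X)`, as a continuous linear functional. -/
def evalFunctional (φ : OpA →ₗ[ℂ] ℂ) (X : OpA) : SuperOp →L[ℂ] ℂ :=
  (LinearMap.toContinuousLinearMap (show AtomSpace →ₗ[ℂ] ℂ from φ)).comp
    (ContinuousLinearMap.apply ℂ AtomSpace (show AtomSpace from X))

/-! ### Dyson coefficients, moments and their derivatives. -/

namespace Params

variable (p : Params)

/-- The coefficients of `𝓛(t₁) ⋯ 𝓛(t_k) (ρ ⊗ |z⟩⟨z|)`. -/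
def stateCoeff (ρ : OpA) (l : List ℝ) : ℕ × ℕ →₀ OpA :=
  l.foldr (fun s x => p.intCoeff s x) (Finsupp.single (0, 0) ρ)

theorem stateCoeff_cons (ρ : OpA) (s : ℝ) (l : List ℝ) :
    p.stateCoeff ρ (s :: l) = p.intCoeff s (p.stateCoeff ρ l) := rfl

/-- Coefficients label a free trajectory, so conjugation by the free evolution does not change them
and each `𝓛(s)` is just `intCoeff s`. -/
theorem insertions_eq (ρ : OpA) (l : List ℝ) :
    p.insertions ρ l = p.evolved (p.stateCoeff ρ l) 0 := by
  induction l with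
  | nil => exact (p.evolved_initial ρ).symm
  | cons s l ih =>
    have h : p.insertions ρ (s :: l) = p.intGenAt s (p.insertions ρ l) := rfl
    rw [h, ih, intGenAt, expFree_evolved, intGen_evolved, expFree_evolved, stateCoeff_cons]
    simp

theorem momentIntegrand_eq (t : ℝ) (ρ : OpA) (l : List ℝ) (a b : Fin 2) :
    p.momentIntegrand t ρ l a b = p.atomPhase t a b * p.stateCoeff ρ l (0, 0) a b := by
  rw [momentIntegrand, insertions_eq, expFree_evolved, partialTrace, zero_add]
  exact (p.hasSum_trace_evolved _ t a b).tsum_eq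

/-- The coefficients of the time-ordered integrals of `𝓛(t₁) ⋯ 𝓛(t_n)`, as superoperators of the
two-level system. -/
def dysonCoeff : ℕ → ℕ → ℕ → ℝ → SuperOp
  | 0, i, j, _ => if i = 0 ∧ j = 0 then 1 else 0
  | n + 1, i, j, t => ∫ s in (0 : ℝ)..t, hierarchyRhs (toSuperOp p.raiseComm) (toSuperOp p.lowerComm)
      (toSuperOp p.lowerLeft) (toSuperOp p.raiseRight) p.z (star p.z) (p.decay s) (p.decayConj s) (fun i j => dysonCoeff n i j s) i j

theorem continuous_decay : Continuous (fun t : ℝ => p.decay t) := by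
  unfold decay; fun_prop

theorem continuous_decayConj : Continuous (fun t : ℝ => p.decayConj t) := by
  unfold decayConj; fun_prop

theorem continuous_rhs_of_continuous {c : ℕ → ℕ → ℝ → SuperOp}
    (hc : ∀ i j, Continuous (c i j)) (i j : ℕ) :
    Continuous (fun s : ℝ => hierarchyRhs (toSuperOp p.raiseComm) (toSuperOp p.lowerComm)
      (toSuperOp p.lowerLeft) (toSuperOp p.raiseRight) p.z
      (star p.z) (p.decay s) (p.decayConj s) (fun i j => c i j s) i j) :=
  continuous_hierarchyRhs _ _ _ _ _ _ p.continuous_decay p.continuous_decayConj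
    (fun _ => p.decay_ne_zero _) (fun _ => p.decayConj_ne_zero _) hc i j

theorem hasDerivAt_integral_rhs {c : ℕ → ℕ → ℝ → SuperOp}
    (hc : ∀ i j, Continuous (c i j)) (i j : ℕ) (t : ℝ) :
    HasDerivAt (fun t => ∫ s in (0 : ℝ)..t, hierarchyRhs (toSuperOp p.raiseComm) (toSuperOp p.lowerComm)
      (toSuperOp p.lowerLeft) (toSuperOp p.raiseRight) p.z (star p.z) (p.decay s) (p.decayConj s) (fun i j => c i j s) i j)
      (hierarchyRhs (toSuperOp p.raiseComm) (toSuperOp p.lowerComm)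
      (toSuperOp p.lowerLeft) (toSuperOp p.raiseRight) p.z (star p.z)
        (p.decay t) (p.decayConj t) (fun i j => c i j t) i j) t :=
  intervalIntegral.integral_hasDerivAt_right
    ((p.continuous_rhs_of_continuous hc i j).intervalIntegrable _ _)
    ((p.continuous_rhs_of_continuous hc i j).stronglyMeasurableAtFilter _ _)
    (p.continuous_rhs_of_continuous hc i j).continuousAt

theorem continuous_dysonCoeff (n i j : ℕ) : Continuous (p.dysonCoeff n i j) := by
  induction n generalizing i j with
  | zero => exact continuous_const
  | succ n ih =>
    exact continuous_iff_continuousAt.mpr fun t => (p.hasDerivAt_integral_rhs ih i j t).continuousAt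

theorem hasDerivAt_dysonCoeff (n i j : ℕ) (t : ℝ) :
    HasDerivAt (p.dysonCoeff (n + 1) i j) (hierarchyRhs (toSuperOp p.raiseComm) (toSuperOp p.lowerComm)
      (toSuperOp p.lowerLeft) (toSuperOp p.raiseRight) p.z (star p.z) (p.decay t) (p.decayConj t)
      (fun i j => p.dysonCoeff n i j t) i j) t :=
  p.hasDerivAt_integral_rhs (p.continuous_dysonCoeff n) i j t

/-- The induction needs every functional `φ` and every index: removing the leftmost `𝓛(s)` replaces
`φ` by `φ ∘ (w • T)` for a ladder superoperator `T` and may shift `(i, j)` by one step. -/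
theorem hasOrderedIntegral_stateCoeff (ρ : OpA) (k : ℕ) (t : ℝ) (φ : OpA →ₗ[ℂ] ℂ) (i j : ℕ) :
    HasOrderedIntegral k t (fun l => φ (p.stateCoeff ρ l (i, j)))
      (φ (act (p.dysonCoeff k i j t) ρ)) := by
  induction k generalizing t φ i j with
  | zero =>
    refine ⟨trivial, ?_⟩
    simp only [orderedIntegral, stateCoeff, dysonCoeff]
    split_ifs with h
    · rw [h.1, h.2, act_one]
      exact congrArg φ Finsupp.single_eq_same
    · rw [act_zero]
      refine congrArg φ (Finsupp.single_eq_of_ne' fun e => h ?_)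
      exact ⟨(Prod.mk_inj.mp e).1.symm, (Prod.mk_inj.mp e).2.symm⟩
  | succ k ih =>
    let Φ := evalFunctional φ ρ
    have hc := p.continuous_rhs_of_continuous (p.continuous_dysonCoeff k) i j
    have h1 : φ (act (p.dysonCoeff (k + 1) i j t) ρ) = ∫ s in (0 : ℝ)..t, Φ (hierarchyRhs (toSuperOp p.raiseComm) (toSuperOp p.lowerComm)
      (toSuperOp p.lowerLeft) (toSuperOp p.raiseRight) p.z (star p.z) (p.decay s) (p.decayConj s)
        (fun i j => p.dysonCoeff k i j s) i j) :=
      (Φ.intervalIntegral_comp_comm (hc.intervalIntegrable 0 t)).symm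
    rw [h1]
    refine HasOrderedIntegral.succ (fun s _ => ?_) ((Φ.continuous.comp hc).intervalIntegrable _ _)
    simp only [stateCoeff_cons, intCoeff_apply, map_add, hierarchyRhs]
    have e : ∀ (w : ℂ) (T : OpA →ₗ[ℂ] OpA) (i j : ℕ),
        HasOrderedIntegral k s (fun l => φ (w • T (p.stateCoeff ρ l (i, j))))
          (Φ (w • (toSuperOp T * p.dysonCoeff k i j s))) := fun w T i j =>
      ih s (φ ∘ₗ (w • T)) i j
    refine (((((e _ _ _ _).add (e _ _ _ _)).add (e _ _ _ _)).add (e _ _ _ _)).add ?_).add ?_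
    · split_ifs
      · simpa using hasOrderedIntegral_zero k s
      · exact e _ _ _ _
    · split_ifs
      · simpa using hasOrderedIntegral_zero k s
      · exact e _ _ _ _

theorem hasOrderedIntegral_momentIntegrand (ρ : OpA) (k : ℕ) (t s : ℝ) (a b : Fin 2) :
    HasOrderedIntegral k s (fun l => p.momentIntegrand t ρ l a b)
      (p.atomPhase t a b * act (p.dysonCoeff k 0 0 s) ρ a b) := by
  simp only [momentIntegrand_eq]
  exact p.hasOrderedIntegral_stateCoeff ρ k s (p.atomPhase t a b • Matrix.entryLinearMap ℂ ℂ a b) 0 0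

/-- The free evolution of the two-level system. -/
def rotation (t : ℝ) : OpA →ₗ[ℂ] OpA where
  toFun X := Matrix.of fun a b => p.atomPhase t a b * X a b
  map_add' X Y := by ext a b; simp [mul_add]
  map_smul' c X := by ext a b; simp; ring

theorem rotation_apply (t : ℝ) (X : OpA) (a b : Fin 2) :
    p.rotation t X a b = p.atomPhase t a b * X a b := rfl

theorem atomPhase_mul_neg (t : ℂ) (a b : Fin 2) : p.atomPhase t a b * p.atomPhase (-t) a b = 1 := by
  rw [atomPhase, atomPhase, ← Complex.exp_add, ← Complex.exp_zero]
  congr 1; ring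

theorem rotation_rotation_neg (t : ℝ) (X : OpA) : p.rotation t (p.rotation (-t) X) = X := by
  ext a b
  rw [rotation_apply, rotation_apply, ← mul_assoc, Complex.ofReal_neg, atomPhase_mul_neg, one_mul]

theorem rotation_neg_rotation (t : ℝ) (X : OpA) : p.rotation (-t) (p.rotation t X) = X := by
  simpa using p.rotation_rotation_neg (-t) X

theorem moment_eq (k : ℕ) (t : ℝ) (ρ : OpA) :
    p.moment k t ρ = p.rotation t (act (p.dysonCoeff k 0 0 t) ρ) := by
  ext a b
  exact (p.hasOrderedIntegral_momentIntegrand ρ k t t a b).2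

theorem moment_zero_eq (t : ℝ) : p.moment 0 t = p.rotation t := by
  funext ρ
  simp [moment_eq, dysonCoeff, act_one]

theorem moment_zero_bijective (t : ℝ) : Function.Bijective (p.moment 0 t) := by
  rw [moment_zero_eq]
  exact Function.bijective_iff_has_inverse.mpr
    ⟨p.rotation (-t), p.rotation_neg_rotation t, p.rotation_rotation_neg t⟩

theorem momentZeroInv_eq (t : ℝ) (X : OpA) : p.momentZeroInv t X = p.rotation (-t) X := by
  apply (p.moment_zero_bijective t).1
  rw [momentZeroInv, Function.rightInverse_invFun (p.moment_zero_bijective t).2 X, moment_zero_eq,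
    rotation_rotation_neg]

/-- The time derivative of `dysonCoeff n 0 0`. -/
def dysonDeriv : ℕ → ℝ → SuperOp
  | 0, _ => 0
  | n + 1, t => hierarchyRhs (toSuperOp p.raiseComm) (toSuperOp p.lowerComm)
      (toSuperOp p.lowerLeft) (toSuperOp p.raiseRight) p.z (star p.z)
      (p.decay t) (p.decayConj t) (fun i j => p.dysonCoeff n i j t) 0 0

theorem hasDerivAt_dysonCoeff_zero_zero (n : ℕ) (t : ℝ) :
    HasDerivAt (p.dysonCoeff n 0 0) (p.dysonDeriv n t) t := by
  rcases n with _ | n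
  · exact hasDerivAt_const t _
  · exact p.hasDerivAt_dysonCoeff n 0 0 t

/-- The generator of the free evolution of the two-level system. -/
def atomGen : OpA →ₗ[ℂ] OpA where
  toFun X := Matrix.of fun a b =>
    -(Complex.I * p.omegaA * (((a : ℕ) : ℂ) - ((b : ℕ) : ℂ))) * X a b
  map_add' X Y := by ext a b; simp; ring
  map_smul' c X := by ext a b; simp; ring

theorem atomGen_apply (X : OpA) (a b : Fin 2) :
    p.atomGen X a b = -(Complex.I * p.omegaA * (((a : ℕ) : ℂ) - ((b : ℕ) : ℂ))) * X a b := rfl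

theorem hasDerivAt_moment (k : ℕ) (t : ℝ) (ρ : OpA) (a b : Fin 2) :
    HasDerivAt (fun s => p.moment k s ρ a b)
      (p.rotation t (p.atomGen (act (p.dysonCoeff k 0 0 t) ρ) + act (p.dysonDeriv k t) ρ) a b) t := by
  have h1 : HasDerivAt (fun s : ℝ => p.atomPhase s a b)
      (p.atomPhase t a b * -(Complex.I * p.omegaA * (((a : ℕ) : ℂ) - ((b : ℕ) : ℂ)))) t :=
    ((((hasDerivAt_id (t : ℂ)).const_mul _).cexp).comp_ofReal).congr_deriv (by simp [atomPhase])
  have h2 : HasDerivAt (fun s : ℝ => act (p.dysonCoeff k 0 0 s) ρ a b) (act (p.dysonDeriv k t) ρ a b) t :=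
    ((evalFunctional (Matrix.entryLinearMap ℂ ℂ a b) ρ).hasFDerivAt.restrictScalars ℝ)
      |>.comp_hasDerivAt t (p.hasDerivAt_dysonCoeff_zero_zero k t)
  simp only [moment_eq, rotation_apply, Matrix.add_apply, atomGen_apply]
  exact (h1.mul h2).congr_deriv (by ring)

theorem momentDeriv_eq (k : ℕ) (t : ℝ) (ρ : OpA) : p.momentDeriv k t ρ
    = p.rotation t (p.atomGen (act (p.dysonCoeff k 0 0 t) ρ) + act (p.dysonDeriv k t) ρ) := by
  ext a b
  exact (p.hasDerivAt_moment k t ρ a b).deriv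

theorem wellDefined (n : ℕ) : p.WellDefined n where
  summable_exp ρ l _ t i j := by
    rw [insertions_eq]
    exact (p.hasSum_expTerm_evolved _ 0 t i j).summable
  summable_exp_neg ρ l _ t i j := by
    rw [insertions_eq, expFree_evolved, intGen_evolved]
    exact (p.hasSum_expTerm_evolved _ _ (-t) i j).summable
  summable_trace ρ l _ t a b := by
    rw [insertions_eq, expFree_evolved]
    exact (p.hasSum_trace_evolved _ _ a b).summable
  integrable ρ k _ t a b := (p.hasOrderedIntegral_momentIntegrand ρ k t t a b).1
  differentiable ρ k _ a b t := (p.hasDerivAt_moment k t ρ a b).differentiableAt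
  bijective := p.moment_zero_bijective

end Params

/-! ### Limits of damped linear equations -/

/-- The integrating factor turns the deviation `w = y - λ⁻¹l` into `u = e^{λt}w` with `u' = e^{λt}(f
- l)`. Once `f` is close to `l`, `u` is at most a constant plus a small multiple of `e^{rt}`, with
`r = Re λ`. -/
theorem tendsto_of_damped_linear {F : Type*} [NormedAddCommGroup F] [NormedSpace ℂ F]
    {y f : ℝ → F} {lam : ℂ} {l : F} (hlam : 0 < lam.re)
    (hy : ∀ t, HasDerivAt y (-(lam • y t) + f t) t) (hf : Tendsto f atTop (𝓝 l)) :
    Tendsto y atTop (𝓝 (lam⁻¹ • l)) := by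
  have hlam0 : lam ≠ 0 := fun h => by simp [h] at hlam
  set r := lam.re with hr
  let w : ℝ → F := fun t => y t - lam⁻¹ • l
  let u : ℝ → F := fun t => Complex.exp (lam * t) • w t
  have hnorm : ∀ t : ℝ, ‖Complex.exp (lam * t)‖ = Real.exp (r * t) := fun t => by
    rw [Complex.norm_exp]; simp [hr]
  have hu : ∀ t : ℝ, HasDerivAt u (Complex.exp (lam * t) • (f t - l)) t := fun t => by
    have h1 : HasDerivAt (fun s : ℝ => Complex.exp (lam * s)) (Complex.exp (lam * t) * lam) t :=
      ((((hasDerivAt_id (t : ℂ)).const_mul lam).cexp).comp_ofReal).congr_deriv (by simp)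
    refine (h1.smul ((hy t).sub_const (lam⁻¹ • l))).congr_deriv ?_
    simp only [smul_sub, smul_add, smul_neg, smul_smul, mul_assoc, mul_inv_cancel₀ hlam0,
      mul_one]
    abel
  rw [Metric.tendsto_atTop]
  intro ε hε
  -- The factor `r` cancels when `e^{rt}` is integrated, leaving `ε / 2` for the forcing; the other
  -- half is for the initial value.
  obtain ⟨T, hT⟩ := Metric.tendsto_atTop.mp hf (ε / 2 * r) (by positivity)
  have hbound : ∀ t, T ≤ t → ‖u t‖ ≤ ‖u T‖ + ε / 2 * (Real.exp (r * t) - Real.exp (r * T)) := by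
    intro t ht
    refine image_norm_le_of_norm_deriv_right_le_deriv_boundary
      (B := fun t => ‖u T‖ + ε / 2 * (Real.exp (r * t) - Real.exp (r * T)))
      (B' := fun t => ε / 2 * (Real.exp (r * t) * r)) (a := T) (b := t)
      (fun s _ => (hu s).continuousAt.continuousWithinAt)
      (fun s _ => (hu s).hasDerivWithinAt) (by simp) (fun s => ?_) (fun s hs => ?_)
      (Set.right_mem_Icc.mpr ht)
    · have := ((((hasDerivAt_id s).const_mul r).exp.sub_const (Real.exp (r * T))).const_mul
        (ε / 2)).const_add ‖u T‖
      simpa using this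
    · rw [norm_smul, hnorm]
      have h2 := (hT s hs.1).le
      rw [dist_eq_norm] at h2
      calc _ ≤ Real.exp (r * s) * (ε / 2 * r) := by gcongr
        _ = _ := by ring
  have hdecay : Tendsto (fun t : ℝ => Real.exp (-(r * t)) * ‖u T‖) atTop (𝓝 0) := by
    have h1 : Tendsto (fun t : ℝ => Real.exp (-(r * t))) atTop (𝓝 0) :=
      Real.tendsto_exp_neg_atTop_nhds_zero.comp (tendsto_id.const_mul_atTop hlam)
    simpa using h1.mul_const ‖u T‖
  obtain ⟨T', hT'⟩ := Metric.tendsto_atTop.mp hdecay (ε / 2) (by positivity)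
  refine ⟨max T T', fun t ht => ?_⟩
  have h1 := hbound t ((le_max_left _ _).trans ht)
  have h2 := hT' t ((le_max_right _ _).trans ht)
  rw [Real.dist_eq, sub_zero] at h2
  replace h2 := (le_abs_self _).trans_lt h2
  have h3 : ‖u t‖ = Real.exp (r * t) * ‖w t‖ := by rw [norm_smul, hnorm]
  have h4 : Real.exp (-(r * t)) * Real.exp (r * t) = 1 := by
    rw [← Real.exp_add, neg_add_cancel, Real.exp_zero]
  have h5 := Real.exp_pos (r * T)
  have h6 := Real.exp_pos (-(r * t))
  rw [dist_eq_norm]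
  change ‖w t‖ < ε
  calc ‖w t‖ = Real.exp (-(r * t)) * ‖u t‖ := by rw [h3, ← mul_assoc, h4, one_mul]
    _ ≤ Real.exp (-(r * t)) * (‖u T‖ + ε / 2 * Real.exp (r * t)) := by
        gcongr
        nlinarith
    _ = Real.exp (-(r * t)) * ‖u T‖ + ε / 2 * (Real.exp (-(r * t)) * Real.exp (r * t)) := by ring
    _ < ε := by rw [h4]; linarith

theorem tendsto_cexp_neg_mul {lam : ℂ} (hlam : 0 < lam.re) :
    Tendsto (fun t : ℝ => Complex.exp (-lam * t)) atTop (𝓝 0) := by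
  rw [tendsto_zero_iff_norm_tendsto_zero]
  have h : ∀ t : ℝ, ‖Complex.exp (-lam * t)‖ = Real.exp (-(lam.re * t)) := fun t => by
    rw [Complex.norm_exp]; simp
  simp only [h]
  exact Real.tendsto_exp_neg_atTop_nhds_zero.comp (tendsto_id.const_mul_atTop hlam)

/-! ### Asymptotics of the hierarchy -/

section Hierarchy

variable {E : Type*} [NormedRing E] [NormedAlgebra ℂ E]

/-- A family of coefficients that solves the hierarchy of coefficient equations. -/
structure IsHierarchy (A B C D : E) (Γ₁ Γ₂ z₁ z₂ : ℂ) (c : ℕ → ℕ → ℕ → ℝ → E) : Prop where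
  zero : ∀ i j t, c 0 i j t = if i = 0 ∧ j = 0 then 1 else 0
  initial : ∀ n i j, c (n + 1) i j 0 = 0
  deriv : ∀ n i j (t : ℝ), HasDerivAt (c (n + 1) i j)
    (hierarchyRhs A B C D z₁ z₂ (Complex.exp (-Γ₁ * t)) (Complex.exp (-Γ₂ * t))
      (fun i j => c n i j t) i j) t

/-- The coefficients multiplied by their decay factors. -/
def scaledCoeff (Γ₁ Γ₂ : ℂ) (c : ℕ → ℕ → ℕ → ℝ → E) (n i j : ℕ) (t : ℝ) : E :=
  (Complex.exp (-Γ₁ * t) ^ i * Complex.exp (-Γ₂ * t) ^ j) • c n i j t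

/-- The contribution of the classical drive. -/
def drive (A B : E) (Γ₁ Γ₂ z₁ z₂ : ℂ) (t : ℝ) : E :=
  (z₁ * Complex.exp (-Γ₁ * t)) • A + (z₂ * Complex.exp (-Γ₂ * t)) • B

/-- First order coefficient of the correlation operator. -/
def corr1 (Γ₁ Γ₂ : ℂ) (c : ℕ → ℕ → ℕ → ℝ → E) (t : ℝ) : E := scaledCoeff Γ₁ Γ₂ c 1 1 0 t

/-- Second order coefficient of the correlation operator. -/
def corr2 (Γ₁ Γ₂ : ℂ) (c : ℕ → ℕ → ℕ → ℝ → E) (t : ℝ) : E :=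
  scaledCoeff Γ₁ Γ₂ c 2 1 0 t - corr1 Γ₁ Γ₂ c t * c 1 0 0 t

/-- Third order coefficient of the correlation operator. -/
def corr3 (Γ₁ Γ₂ : ℂ) (c : ℕ → ℕ → ℕ → ℝ → E) (t : ℝ) : E :=
  scaledCoeff Γ₁ Γ₂ c 3 1 0 t - corr2 Γ₁ Γ₂ c t * c 1 0 0 t - corr1 Γ₁ Γ₂ c t * c 2 0 0 t

/-- The coefficients with the roles of the two derivatives exchanged. -/
def swapCoeff (c : ℕ → ℕ → ℕ → ℝ → E) : ℕ → ℕ → ℕ → ℝ → E := fun n i j => c n j i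

/-- Second order coefficient of the time-local generator. -/
def localGen2 (A B : E) (Γ₁ Γ₂ : ℂ) (c : ℕ → ℕ → ℕ → ℝ → E) (t : ℝ) : E :=
  A * corr1 Γ₁ Γ₂ c t + B * corr1 Γ₂ Γ₁ (swapCoeff c) t

/-- Third order coefficient of the time-local generator. -/
def localGen3 (A B : E) (Γ₁ Γ₂ : ℂ) (c : ℕ → ℕ → ℕ → ℝ → E) (t : ℝ) : E :=
  A * corr2 Γ₁ Γ₂ c t + B * corr2 Γ₂ Γ₁ (swapCoeff c) t

/-- Fourth order coefficient of the time-local generator. -/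
def localGen4 (A B : E) (Γ₁ Γ₂ : ℂ) (c : ℕ → ℕ → ℕ → ℝ → E) (t : ℝ) : E :=
  A * corr3 Γ₁ Γ₂ c t + B * corr3 Γ₂ Γ₁ (swapCoeff c) t

theorem scaledCoeff_zero_zero (Γ₁ Γ₂ : ℂ) (c : ℕ → ℕ → ℕ → ℝ → E) (n : ℕ) (t : ℝ) :
    scaledCoeff Γ₁ Γ₂ c n 0 0 t = c n 0 0 t := by simp [scaledCoeff]

theorem scaledCoeff_swap (Γ₁ Γ₂ : ℂ) (c : ℕ → ℕ → ℕ → ℝ → E) (n i j : ℕ) (t : ℝ) :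
    scaledCoeff Γ₂ Γ₁ (swapCoeff c) n i j t = scaledCoeff Γ₁ Γ₂ c n j i t := by
  simp [scaledCoeff, swapCoeff, mul_comm]

theorem tendsto_drive (A B : E) {Γ₁ Γ₂ : ℂ} (z₁ z₂ : ℂ) (h₁ : 0 < Γ₁.re) (h₂ : 0 < Γ₂.re) :
    Tendsto (drive A B Γ₁ Γ₂ z₁ z₂) atTop (𝓝 0) := by
  have h := (((tendsto_cexp_neg_mul h₁).const_mul z₁).smul_const A).add
    (((tendsto_cexp_neg_mul h₂).const_mul z₂).smul_const B)
  rw [mul_zero, mul_zero, zero_smul, zero_smul, add_zero] at h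
  exact h

namespace IsHierarchy

variable {A B C D : E} {Γ₁ Γ₂ z₁ z₂ : ℂ} {c : ℕ → ℕ → ℕ → ℝ → E}

theorem swap (h : IsHierarchy A B C D Γ₁ Γ₂ z₁ z₂ c) :
    IsHierarchy B A D C Γ₂ Γ₁ z₂ z₁ (swapCoeff c) where
  zero i j t := by simp only [swapCoeff, h.zero, and_comm]
  initial n i j := h.initial n j i
  deriv n i j t := (h.deriv n j i t).congr_deriv (by simp only [hierarchyRhs, swapCoeff]; abel)

/-- The rescaling cancels the growing factors `a⁻¹`, `b⁻¹` of `C`, `D` and the decaying ones of the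
lowering terms. Explicit time dependence remains only in the drive, and damping at rate `iΓ₁ + jΓ₂`
appears. -/
theorem scaledCoeff_deriv (h : IsHierarchy A B C D Γ₁ Γ₂ z₁ z₂ c) (n i j : ℕ) (t : ℝ) :
    HasDerivAt (scaledCoeff Γ₁ Γ₂ c (n + 1) i j)
      (-((i * Γ₁ + j * Γ₂) • scaledCoeff Γ₁ Γ₂ c (n + 1) i j t)
        + (drive A B Γ₁ Γ₂ z₁ z₂ t * scaledCoeff Γ₁ Γ₂ c n i j t
        + ((i + 1 : ℕ) : ℂ) • (A * scaledCoeff Γ₁ Γ₂ c n (i + 1) j t)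
        + ((j + 1 : ℕ) : ℂ) • (B * scaledCoeff Γ₁ Γ₂ c n i (j + 1) t)
        + (if i = 0 then 0 else C * scaledCoeff Γ₁ Γ₂ c n (i - 1) j t)
        + (if j = 0 then 0 else D * scaledCoeff Γ₁ Γ₂ c n i (j - 1) t))) t := by
  have h1 : HasDerivAt (fun s : ℝ => Complex.exp (-Γ₁ * s) ^ i * Complex.exp (-Γ₂ * s) ^ j)
      (-(i * Γ₁ + j * Γ₂) * (Complex.exp (-Γ₁ * t) ^ i * Complex.exp (-Γ₂ * t) ^ j)) t := by
    have e : ∀ s : ℝ, Complex.exp (-Γ₁ * s) ^ i * Complex.exp (-Γ₂ * s) ^ j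
        = Complex.exp (-(i * Γ₁ + j * Γ₂) * s) := fun s => by
      rw [← Complex.exp_nat_mul, ← Complex.exp_nat_mul, ← Complex.exp_add]
      congr 1; ring
    simp only [e]
    exact ((((hasDerivAt_id (t : ℂ)).const_mul _).cexp).comp_ofReal).congr_deriv (by
      simp [mul_comm])
  refine (h1.smul (h.deriv n i j t)).congr_deriv ?_
  have ha := Complex.exp_ne_zero (-Γ₁ * t)
  have hb := Complex.exp_ne_zero (-Γ₂ * t)
  simp only [scaledCoeff, hierarchyRhs, drive]
  generalize Complex.exp (-Γ₁ * t) = a at ha ⊢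
  generalize Complex.exp (-Γ₂ * t) = b at hb ⊢
  have e1 : (a ^ i * b ^ j) • (if i = 0 then 0 else a⁻¹ • (C * c n (i - 1) j t))
      = if i = 0 then 0 else (a ^ (i - 1) * b ^ j) • (C * c n (i - 1) j t) := by
    rcases i with _ | i
    · simp
    · simp only [Nat.add_sub_cancel, Nat.succ_ne_zero, if_false, smul_smul]
      congr 1; field_simp; ring
  have e2 : (a ^ i * b ^ j) • (if j = 0 then 0 else b⁻¹ • (D * c n i (j - 1) t))
      = if j = 0 then 0 else (a ^ i * b ^ (j - 1)) • (D * c n i (j - 1) t) := by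
    rcases j with _ | j
    · simp
    · simp only [Nat.add_sub_cancel, Nat.succ_ne_zero, if_false, smul_smul]
      congr 1; field_simp; ring
  simp only [smul_add, e1, e2, mul_smul_comm, smul_mul_assoc, add_mul]
  rw [← sub_eq_zero]
  abel_nf
  module

theorem scaledCoeff_zero_eq_zero (h : IsHierarchy A B C D Γ₁ Γ₂ z₁ z₂ c) {i j : ℕ}
    (hij : 1 ≤ i + j) (t : ℝ) : scaledCoeff Γ₁ Γ₂ c 0 i j t = 0 := by
  rw [scaledCoeff, h.zero, if_neg (by omega), smul_zero]

theorem scaledCoeff_zero_eq_one (h : IsHierarchy A B C D Γ₁ Γ₂ z₁ z₂ c) (t : ℝ) :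
    scaledCoeff Γ₁ Γ₂ c 0 0 0 t = 1 := by
  rw [scaledCoeff_zero_zero, h.zero, if_pos ⟨rfl, rfl⟩]

/-- One insertion raises the total derivative order by at most one. -/
theorem scaledCoeff_one_eq_zero (h : IsHierarchy A B C D Γ₁ Γ₂ z₁ z₂ c) {i j : ℕ}
    (hij : 2 ≤ i + j) (t : ℝ) : scaledCoeff Γ₁ Γ₂ c 1 i j t = 0 := by
  have hd : ∀ s, HasDerivAt (c 1 i j) 0 s := fun s => by
    refine (h.deriv 0 i j s).congr_deriv ?_
    simp only [hierarchyRhs, h.zero]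
    rw [if_neg (by omega), if_neg (by omega), if_neg (by omega)]
    simp only [mul_zero, smul_zero, add_zero, zero_add]
    have e1 : ¬ (i - 1 = 0 ∧ j = 0) := by omega
    have e2 : ¬ (i = 0 ∧ j - 1 = 0) := by omega
    simp [e1, e2]
  have e : c 1 i j t = c 1 i j 0 :=
    is_const_of_deriv_eq_zero (fun s => (hd s).differentiableAt) (fun s => (hd s).deriv) t 0
  rw [scaledCoeff, e, h.initial, smul_zero]

theorem corr1_deriv (h : IsHierarchy A B C D Γ₁ Γ₂ z₁ z₂ c) (t : ℝ) :
    HasDerivAt (corr1 Γ₁ Γ₂ c) (-(Γ₁ • corr1 Γ₁ Γ₂ c t) + C) t := by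
  refine (h.scaledCoeff_deriv 0 1 0 t).congr_deriv ?_
  rw [h.scaledCoeff_zero_eq_zero (i := 1) (j := 0) (by norm_num),
    h.scaledCoeff_zero_eq_zero (i := 1 + 1) (j := 0) (by norm_num),
    h.scaledCoeff_zero_eq_zero (i := 1) (j := 0 + 1) (by norm_num)]
  simp [h.scaledCoeff_zero_eq_one, corr1]

theorem coeff_deriv (h : IsHierarchy A B C D Γ₁ Γ₂ z₁ z₂ c) (n : ℕ) (t : ℝ) :
    HasDerivAt (c (n + 1) 0 0) (drive A B Γ₁ Γ₂ z₁ z₂ t * c n 0 0 t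
      + A * scaledCoeff Γ₁ Γ₂ c n 1 0 t + B * scaledCoeff Γ₁ Γ₂ c n 0 1 t) t := by
  have e := h.scaledCoeff_deriv n 0 0 t
  have e' : scaledCoeff Γ₁ Γ₂ c (n + 1) 0 0 = c (n + 1) 0 0 :=
    funext fun s => scaledCoeff_zero_zero Γ₁ Γ₂ c (n + 1) s
  rw [e'] at e
  refine e.congr_deriv ?_
  simp [scaledCoeff_zero_zero]

theorem coeff1_deriv (h : IsHierarchy A B C D Γ₁ Γ₂ z₁ z₂ c) (t : ℝ) :
    HasDerivAt (c 1 0 0) (drive A B Γ₁ Γ₂ z₁ z₂ t) t := by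
  refine (h.coeff_deriv 0 t).congr_deriv ?_
  rw [h.scaledCoeff_zero_eq_zero (i := 1) (j := 0) (by norm_num),
    h.scaledCoeff_zero_eq_zero (i := 0) (j := 1) (by norm_num), h.zero]
  simp

/-- This equation and its analogues at the other orders expand `ċ₀₀ = (drive + AW + BW̃)c₀₀`. They
identify `localGen2`, `localGen3`, `localGen4` as the orders of `ċ₀₀c₀₀⁻¹`. -/
theorem coeff2_deriv (h : IsHierarchy A B C D Γ₁ Γ₂ z₁ z₂ c) (t : ℝ) :
    HasDerivAt (c 2 0 0) (drive A B Γ₁ Γ₂ z₁ z₂ t * c 1 0 0 t + localGen2 A B Γ₁ Γ₂ c t) t := by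
  refine (h.coeff_deriv 1 t).congr_deriv ?_
  simp only [localGen2, corr1, scaledCoeff_swap]
  abel

theorem coeff3_deriv (h : IsHierarchy A B C D Γ₁ Γ₂ z₁ z₂ c) (t : ℝ) :
    HasDerivAt (c 3 0 0) (drive A B Γ₁ Γ₂ z₁ z₂ t * c 2 0 0 t
      + localGen2 A B Γ₁ Γ₂ c t * c 1 0 0 t + localGen3 A B Γ₁ Γ₂ c t) t := by
  refine (h.coeff_deriv 2 t).congr_deriv ?_
  simp only [localGen2, localGen3, corr2, corr1, scaledCoeff_swap]
  simp only [swapCoeff]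
  noncomm_ring

theorem coeff4_deriv (h : IsHierarchy A B C D Γ₁ Γ₂ z₁ z₂ c) (t : ℝ) :
    HasDerivAt (c 4 0 0) (drive A B Γ₁ Γ₂ z₁ z₂ t * c 3 0 0 t
      + localGen2 A B Γ₁ Γ₂ c t * c 2 0 0 t + localGen3 A B Γ₁ Γ₂ c t * c 1 0 0 t
      + localGen4 A B Γ₁ Γ₂ c t) t := by
  refine (h.coeff_deriv 3 t).congr_deriv ?_
  simp only [localGen2, localGen3, localGen4, corr3, corr2, corr1, scaledCoeff_swap]
  simp only [swapCoeff]
  noncomm_ring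

theorem corr2_deriv (h : IsHierarchy A B C D Γ₁ Γ₂ z₁ z₂ c) (t : ℝ) :
    HasDerivAt (corr2 Γ₁ Γ₂ c) (-(Γ₁ • corr2 Γ₁ Γ₂ c t)
      + (drive A B Γ₁ Γ₂ z₁ z₂ t * corr1 Γ₁ Γ₂ c t
        - corr1 Γ₁ Γ₂ c t * drive A B Γ₁ Γ₂ z₁ z₂ t)) t := by
  refine ((h.scaledCoeff_deriv 1 1 0 t).sub
    ((h.corr1_deriv t).mul (h.coeff1_deriv t))).congr_deriv ?_
  rw [h.scaledCoeff_one_eq_zero (i := 1 + 1) (j := 0) (by norm_num),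
    h.scaledCoeff_one_eq_zero (i := 1) (j := 0 + 1) (by norm_num)]
  simp only [corr2, ← scaledCoeff_zero_zero Γ₁ Γ₂ c]
  simp only [corr1, mul_zero, smul_zero, add_zero, one_ne_zero, if_false, if_true, Nat.sub_self,
    Nat.cast_one, Nat.cast_zero, one_mul, zero_mul, smul_sub, add_mul, neg_mul, smul_mul_assoc]
  abel

/-- Third order of a Riccati-type equation: differentiating `W = S₁₀c₀₀⁻¹` produces `-W·ċ₀₀c₀₀⁻¹`,
whose second-order factor gives the last term. Two simultaneous excitations enter through `S₂₀` and
`S₁₁`. -/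
theorem corr3_deriv (h : IsHierarchy A B C D Γ₁ Γ₂ z₁ z₂ c) (t : ℝ) :
    HasDerivAt (corr3 Γ₁ Γ₂ c) (-(Γ₁ • corr3 Γ₁ Γ₂ c t)
      + (drive A B Γ₁ Γ₂ z₁ z₂ t * corr2 Γ₁ Γ₂ c t
        + (2 : ℂ) • (A * scaledCoeff Γ₁ Γ₂ c 2 2 0 t) + B * scaledCoeff Γ₁ Γ₂ c 2 1 1 t
        - corr2 Γ₁ Γ₂ c t * drive A B Γ₁ Γ₂ z₁ z₂ t
        - corr1 Γ₁ Γ₂ c t * localGen2 A B Γ₁ Γ₂ c t)) t := by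
  refine (((h.scaledCoeff_deriv 2 1 0 t).sub
    ((h.corr2_deriv t).mul (h.coeff1_deriv t))).sub
    ((h.corr1_deriv t).mul (h.coeff2_deriv t))).congr_deriv ?_
  generalize localGen2 A B Γ₁ Γ₂ c t = K
  have e1 : scaledCoeff Γ₁ Γ₂ c 3 1 0 t
      = corr3 Γ₁ Γ₂ c t + corr2 Γ₁ Γ₂ c t * c 1 0 0 t + corr1 Γ₁ Γ₂ c t * c 2 0 0 t := by
    simp only [corr3]; abel
  have e2 : scaledCoeff Γ₁ Γ₂ c 2 1 0 t = corr2 Γ₁ Γ₂ c t + corr1 Γ₁ Γ₂ c t * c 1 0 0 t := by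
    simp only [corr2]; abel
  simp only [Nat.reduceAdd, e1, e2, scaledCoeff_zero_zero, one_ne_zero, if_false, if_true,
    Nat.sub_self, Nat.cast_one, Nat.cast_zero, Nat.cast_ofNat, one_mul, zero_mul, add_zero,
    one_smul, smul_add, add_mul, sub_mul, mul_add, neg_mul, smul_mul_assoc, mul_assoc]
  abel

/-! ### Long-time limits of the correlation coefficients. -/

theorem tendsto_corr1 (h : IsHierarchy A B C D Γ₁ Γ₂ z₁ z₂ c) (h₁ : 0 < Γ₁.re) :
    Tendsto (corr1 Γ₁ Γ₂ c) atTop (𝓝 (Γ₁⁻¹ • C)) :=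
  tendsto_of_damped_linear h₁ h.corr1_deriv tendsto_const_nhds

/-- Its only source is the commutator of the decaying drive with the convergent `corr1`. -/
theorem tendsto_corr2 (h : IsHierarchy A B C D Γ₁ Γ₂ z₁ z₂ c) (h₁ : 0 < Γ₁.re)
    (h₂ : 0 < Γ₂.re) : Tendsto (corr2 Γ₁ Γ₂ c) atTop (𝓝 0) := by
  have hd := tendsto_drive A B z₁ z₂ h₁ h₂
  have hw := h.tendsto_corr1 h₁
  have := tendsto_of_damped_linear h₁ h.corr2_deriv ((hd.mul hw).sub (hw.mul hd))
  simpa using this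

/-- The source is `C * corr1`, which tends to `Γ₁⁻¹C² = 0`: the atom cannot be lowered twice. -/
theorem tendsto_scaledCoeff_two_zero (h : IsHierarchy A B C D Γ₁ Γ₂ z₁ z₂ c) (h₁ : 0 < Γ₁.re)
    (hC : C * C = 0) : Tendsto (scaledCoeff Γ₁ Γ₂ c 2 2 0) atTop (𝓝 0) := by
  have hd : ∀ t, HasDerivAt (scaledCoeff Γ₁ Γ₂ c 2 2 0)
      (-((2 * Γ₁) • scaledCoeff Γ₁ Γ₂ c 2 2 0 t) + C * corr1 Γ₁ Γ₂ c t) t := fun t => by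
    refine (h.scaledCoeff_deriv 1 2 0 t).congr_deriv ?_
    rw [h.scaledCoeff_one_eq_zero (i := 2) (j := 0) (by norm_num),
      h.scaledCoeff_one_eq_zero (i := 2 + 1) (j := 0) (by norm_num),
      h.scaledCoeff_one_eq_zero (i := 2) (j := 0 + 1) (by norm_num)]
    simp [corr1]
  have := tendsto_of_damped_linear (by simpa using h₁) hd ((h.tendsto_corr1 h₁).const_mul C)
  simpa [hC] using this

theorem tendsto_scaledCoeff_one_one (h : IsHierarchy A B C D Γ₁ Γ₂ z₁ z₂ c) (h₁ : 0 < Γ₁.re)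
    (h₂ : 0 < Γ₂.re) : Tendsto (scaledCoeff Γ₁ Γ₂ c 2 1 1) atTop
      (𝓝 ((Γ₁ + Γ₂)⁻¹ • (Γ₂⁻¹ • (C * D) + Γ₁⁻¹ • (D * C)))) := by
  have hd : ∀ t, HasDerivAt (scaledCoeff Γ₁ Γ₂ c 2 1 1)
      (-((Γ₁ + Γ₂) • scaledCoeff Γ₁ Γ₂ c 2 1 1 t)
        + (C * corr1 Γ₂ Γ₁ (swapCoeff c) t + D * corr1 Γ₁ Γ₂ c t)) t := fun t => by
    refine (h.scaledCoeff_deriv 1 1 1 t).congr_deriv ?_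
    rw [h.scaledCoeff_one_eq_zero (i := 1) (j := 1) (by norm_num),
      h.scaledCoeff_one_eq_zero (i := 1 + 1) (j := 1) (by norm_num),
      h.scaledCoeff_one_eq_zero (i := 1) (j := 1 + 1) (by norm_num)]
    simp [corr1, scaledCoeff_swap]
  have := tendsto_of_damped_linear (by simpa using add_pos h₁ h₂) hd
    (((h.swap.tendsto_corr1 h₂).const_mul C).add ((h.tendsto_corr1 h₁).const_mul D))
  simpa [mul_smul_comm] using this

theorem tendsto_localGen2 (h : IsHierarchy A B C D Γ₁ Γ₂ z₁ z₂ c) (h₁ : 0 < Γ₁.re)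
    (h₂ : 0 < Γ₂.re) : Tendsto (localGen2 A B Γ₁ Γ₂ c) atTop
      (𝓝 (Γ₁⁻¹ • (A * C) + Γ₂⁻¹ • (B * D))) := by
  have e := ((h.tendsto_corr1 h₁).const_mul A).add ((h.swap.tendsto_corr1 h₂).const_mul B)
  rw [mul_smul_comm, mul_smul_comm] at e
  exact e

theorem tendsto_corr3 (h : IsHierarchy A B C D Γ₁ Γ₂ z₁ z₂ c) (h₁ : 0 < Γ₁.re)
    (h₂ : 0 < Γ₂.re) (hC : C * C = 0) : Tendsto (corr3 Γ₁ Γ₂ c) atTop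
      (𝓝 (Γ₁⁻¹ • (B * ((Γ₁ + Γ₂)⁻¹ • (Γ₂⁻¹ • (C * D) + Γ₁⁻¹ • (D * C)))
        - (Γ₁⁻¹ • C) * (Γ₁⁻¹ • (A * C) + Γ₂⁻¹ • (B * D))))) := by
  have hd := tendsto_drive A B z₁ z₂ h₁ h₂
  have hw := h.tendsto_corr2 h₁ h₂
  have := tendsto_of_damped_linear h₁ h.corr3_deriv
    (((((hd.mul hw).add (((h.tendsto_scaledCoeff_two_zero h₁ hC).const_mul A).const_smul
      (2 : ℂ))).add ((h.tendsto_scaledCoeff_one_one h₁ h₂).const_mul B)).sub (hw.mul hd)).sub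
      ((h.tendsto_corr1 h₁).mul (h.tendsto_localGen2 h₁ h₂)))
  simpa only [mul_zero, smul_zero, add_zero, zero_add, sub_zero] using this

theorem tendsto_localGen4 (h : IsHierarchy A B C D Γ₁ Γ₂ z₁ z₂ c) (h₁ : 0 < Γ₁.re)
    (h₂ : 0 < Γ₂.re) (hC : C * C = 0) (hD : D * D = 0) :
    Tendsto (localGen4 A B Γ₁ Γ₂ c) atTop
      (𝓝 (A * (Γ₁⁻¹ • (B * ((Γ₁ + Γ₂)⁻¹ • (Γ₂⁻¹ • (C * D) + Γ₁⁻¹ • (D * C)))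
          - (Γ₁⁻¹ • C) * (Γ₁⁻¹ • (A * C) + Γ₂⁻¹ • (B * D))))
        + B * (Γ₂⁻¹ • (A * ((Γ₂ + Γ₁)⁻¹ • (Γ₁⁻¹ • (D * C) + Γ₂⁻¹ • (C * D)))
          - (Γ₂⁻¹ • D) * (Γ₂⁻¹ • (B * D) + Γ₁⁻¹ • (A * C)))))) :=
  ((h.tendsto_corr3 h₁ h₂ hC).const_mul A).add ((h.swap.tendsto_corr3 h₂ h₁ hD).const_mul B)

end IsHierarchy

end Hierarchy

/-! ### Cumulants as time-local generators -/

/-- The coefficient of order `n` of `(∑ₖ D k) (∑ₖ c k)⁻¹` for `c 0 = 1`. -/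
def quotientCoeff {E : Type*} [Ring E] [Algebra ℂ E] (D c : ℕ → E) (n : ℕ) : E :=
  ∑ q ∈ Finset.range (n + 1), (-1 : ℂ) ^ q •
    ∑ k ∈ (Finset.Nat.antidiagonalTuple (q + 1) n).filter (fun k => ∀ j : Fin q, 1 ≤ k j.succ),
      D (k 0) * (List.ofFn (fun j : Fin q => c (k j.succ))).prod

theorem filter_antidiagonalTuple_zero (n : ℕ) :
    (Finset.Nat.antidiagonalTuple (0 + 1) n).filter (fun k => ∀ j : Fin 0, 1 ≤ k j.succ)
      = {![n]} := by
  simp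

theorem quotientCoeff_two {E : Type*} [Ring E] [Algebra ℂ E] (D c : ℕ → E) :
    quotientCoeff D c 2 = D 2 - D 1 * c 1 - D 0 * c 2 + D 0 * c 1 * c 1 := by
  have h1 : (Finset.Nat.antidiagonalTuple (1 + 1) 2).filter (fun k => ∀ j : Fin 1, 1 ≤ k j.succ)
      = {![0, 2], ![1, 1]} := by decide
  have h2 : (Finset.Nat.antidiagonalTuple (2 + 1) 2).filter (fun k => ∀ j : Fin 2, 1 ≤ k j.succ)
      = {![0, 1, 1]} := by decide
  simp only [quotientCoeff, Finset.sum_range_succ, Finset.sum_range_zero,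
    filter_antidiagonalTuple_zero, h1, h2]
  simp [Matrix.vecCons_inj, List.ofFn_succ]
  noncomm_ring

theorem quotientCoeff_four {E : Type*} [Ring E] [Algebra ℂ E] (D c : ℕ → E) :
    quotientCoeff D c 4 = D 4 - (D 3 * c 1 + D 2 * c 2 + D 1 * c 3 + D 0 * c 4)
      + (D 2 * c 1 * c 1 + D 1 * c 1 * c 2 + D 1 * c 2 * c 1 + D 0 * c 1 * c 3 + D 0 * c 2 * c 2
        + D 0 * c 3 * c 1)
      - (D 1 * c 1 * c 1 * c 1 + D 0 * c 1 * c 1 * c 2 + D 0 * c 1 * c 2 * c 1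
        + D 0 * c 2 * c 1 * c 1)
      + D 0 * c 1 * c 1 * c 1 * c 1 := by
  have h1 : (Finset.Nat.antidiagonalTuple (1 + 1) 4).filter (fun k => ∀ j : Fin 1, 1 ≤ k j.succ)
      = {![0, 4], ![1, 3], ![2, 2], ![3, 1]} := by decide
  have h2 : (Finset.Nat.antidiagonalTuple (2 + 1) 4).filter (fun k => ∀ j : Fin 2, 1 ≤ k j.succ)
      = {![0, 1, 3], ![0, 2, 2], ![0, 3, 1], ![1, 1, 2], ![1, 2, 1], ![2, 1, 1]} := by decide
  have h3 : (Finset.Nat.antidiagonalTuple (3 + 1) 4).filter (fun k => ∀ j : Fin 3, 1 ≤ k j.succ)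
      = {![0, 1, 1, 2], ![0, 1, 2, 1], ![0, 2, 1, 1], ![1, 1, 1, 1]} := by decide
  have h4 : (Finset.Nat.antidiagonalTuple (4 + 1) 4).filter (fun k => ∀ j : Fin 4, 1 ≤ k j.succ)
      = {![0, 1, 1, 1, 1]} := by decide
  simp only [quotientCoeff, Finset.sum_range_succ, Finset.sum_range_zero,
    filter_antidiagonalTuple_zero, h1, h2, h3, h4]
  have p3 : (-1 : ℂ) ^ 3 = -1 := by norm_num
  have p4 : (-1 : ℂ) ^ 4 = 1 := by norm_num
  simp only [p3, p4, one_smul, neg_smul]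
  simp [Matrix.vecCons_inj, List.ofFn_succ]
  noncomm_ring

namespace Params

variable (p : Params)

theorem isHierarchy_dysonCoeff : IsHierarchy (toSuperOp p.raiseComm) (toSuperOp p.lowerComm)
    (toSuperOp p.lowerLeft) (toSuperOp p.raiseRight) p.Gam (star p.Gam) p.z (star p.z)
    p.dysonCoeff where
  zero _ _ _ := rfl
  initial _ _ _ := intervalIntegral.integral_same
  deriv := p.hasDerivAt_dysonCoeff

/-- The second order time-local generator. -/
def localGenTwo (t : ℝ) : SuperOp :=
  localGen2 (toSuperOp p.raiseComm) (toSuperOp p.lowerComm) p.Gam (star p.Gam) p.dysonCoeff t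

/-- The fourth order time-local generator. -/
def localGenFour (t : ℝ) : SuperOp :=
  localGen4 (toSuperOp p.raiseComm) (toSuperOp p.lowerComm) p.Gam (star p.Gam) p.dysonCoeff t

theorem dysonDeriv_unique {n : ℕ} {t : ℝ} {S : SuperOp}
    (h : HasDerivAt (p.dysonCoeff n 0 0) S t) : p.dysonDeriv n t = S :=
  (p.hasDerivAt_dysonCoeff_zero_zero n t).unique h

/-- Each `𝓞₀⁻¹` cancels the rotation of the moment on its right, so the rotations survive only at
the two ends. -/
theorem rotation_neg_foldr (t : ℝ) (ρ : OpA) (l : List ℕ) :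
    p.rotation (-t) (l.foldr (fun m X => p.moment m t (p.momentZeroInv t X)) ρ)
      = act ((l.map fun m => p.dysonCoeff m 0 0 t).prod) (p.rotation (-t) ρ) := by
  induction l with
  | nil => rfl
  | cons m l ih =>
    rw [List.foldr_cons, momentZeroInv_eq, ih, moment_eq, rotation_neg_rotation, List.map_cons,
      List.prod_cons, act_mul]

theorem cumulantTerm_eq (t : ℝ) (ρ : OpA) (q : ℕ) (k : Fin (q + 1) → ℕ) :
    p.cumulantTerm t ρ q k = p.rotation t (act
      ((toSuperOp p.atomGen * p.dysonCoeff (k 0) 0 0 t + p.dysonDeriv (k 0) t)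
        * (List.ofFn (fun j : Fin q => p.dysonCoeff (k j.succ) 0 0 t)).prod)
      (p.rotation (-t) ρ)) := by
  rw [cumulantTerm, momentZeroInv_eq, rotation_neg_foldr, momentDeriv_eq, List.map_ofFn]
  rfl

theorem cumulant_eq (n : ℕ) (t : ℝ) (ρ : OpA) : p.cumulant n t ρ = p.rotation t (act
    (quotientCoeff (fun k => toSuperOp p.atomGen * p.dysonCoeff k 0 0 t + p.dysonDeriv k t)
      (fun k => p.dysonCoeff k 0 0 t) n) (p.rotation (-t) ρ)) := by
  let Φ : SuperOp →ₗ[ℂ] OpA :=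
    { toFun := fun S => p.rotation t (act S (p.rotation (-t) ρ))
      map_add' := fun S T => by rw [act_add, map_add]
      map_smul' := fun c S => by rw [act_smul, map_smul]; rfl }
  have h : ∀ S, p.rotation t (act S (p.rotation (-t) ρ)) = Φ S := fun _ => rfl
  simp only [cumulant, cumulantTerm_eq, quotientCoeff, h, map_sum, map_smul]

/-- The `atomGen` part of the numerator is `atomGen` times the denominator, so it contributes to the
quotient at order zero only and cancels here, as it does at order four. -/
theorem cumulant_two_eq (t : ℝ) (ρ : OpA) :
    p.cumulant 2 t ρ = p.rotation t (act (p.localGenTwo t) (p.rotation (-t) ρ)) := by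
  have h := p.isHierarchy_dysonCoeff
  have e0 : p.dysonCoeff 0 0 0 t = 1 := h.zero 0 0 t
  have d0 : p.dysonDeriv 0 t = 0 := rfl
  rw [cumulant_eq, quotientCoeff_two, d0, p.dysonDeriv_unique (h.coeff1_deriv t),
    p.dysonDeriv_unique (h.coeff2_deriv t), e0]
  congr 2
  simp only [localGenTwo]
  noncomm_ring

theorem cumulant_four_eq (t : ℝ) (ρ : OpA) :
    p.cumulant 4 t ρ = p.rotation t (act (p.localGenFour t) (p.rotation (-t) ρ)) := by
  have h := p.isHierarchy_dysonCoeff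
  have e0 : p.dysonCoeff 0 0 0 t = 1 := h.zero 0 0 t
  have d0 : p.dysonDeriv 0 t = 0 := rfl
  rw [cumulant_eq, quotientCoeff_four, d0, p.dysonDeriv_unique (h.coeff1_deriv t),
    p.dysonDeriv_unique (h.coeff2_deriv t), p.dysonDeriv_unique (h.coeff3_deriv t),
    p.dysonDeriv_unique (h.coeff4_deriv t), e0]
  congr 2
  simp only [localGenFour]
  noncomm_ring

/-! ### Limits -/

theorem norm_atomPhase (t : ℝ) (a b : Fin 2) : ‖p.atomPhase t a b‖ = 1 := by
  rw [atomPhase, show -(Complex.I * p.omegaA * (((a : ℕ) : ℂ) - ((b : ℕ) : ℂ))) * (t : ℂ)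
    = ((-(p.omegaA * (((a : ℕ) : ℝ) - ((b : ℕ) : ℝ)) * t) : ℝ) : ℂ) * Complex.I by push_cast; ring]
  exact Complex.norm_exp_ofReal_mul_I _

theorem norm_rotation (t : ℝ) (X : OpA) :
    ‖(show AtomSpace from p.rotation t X)‖ = ‖(show AtomSpace from X)‖ := by
  have h : ∀ a b, ‖p.rotation t X a b‖₊ = ‖X a b‖₊ := fun a b => by
    rw [rotation_apply, nnnorm_mul, ← NNReal.coe_inj, NNReal.coe_mul, coe_nnnorm, coe_nnnorm,
      norm_atomPhase, one_mul]
  have e : ∀ Y : AtomSpace, ‖Y‖ = ((Finset.univ.sup fun a => Finset.univ.sup fun b => ‖Y a b‖₊ :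
      NNReal) : ℝ) := fun Y => by simp only [Pi.norm_def, Pi.nnnorm_def]
  rw [e, e]
  exact congrArg _ (Finset.sup_congr rfl fun a _ => Finset.sup_congr rfl fun b _ => h a b)

/-- Limits of superoperators that commute with the free evolution are the same in the Schrödinger
picture and in the interaction picture. -/
theorem tendsto_rotation_conj {K : ℝ → SuperOp} {L : SuperOp} (hK : Tendsto K atTop (𝓝 L))
    (hL : ∀ t X, p.rotation t (act L X) = act L (p.rotation t X)) (ρ : OpA) :
    Tendsto (fun t => p.rotation t (act (K t) (p.rotation (-t) ρ))) atTop (𝓝 (act L ρ)) := by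
  have key : Tendsto (fun t => (show AtomSpace from p.rotation t (act (K t) (p.rotation (-t) ρ))))
      atTop (𝓝 (show AtomSpace from act L ρ)) := by
    rw [tendsto_iff_norm_sub_tendsto_zero] at hK ⊢
    refine squeeze_zero (fun _ => norm_nonneg _) (fun t => ?_)
      (by simpa using hK.mul_const ‖(show AtomSpace from ρ)‖)
    -- As `L` commutes with the rotation, the error is a rotated `K t - L`; rotations multiply
    -- entries by phases and preserve the norm.
    have e : p.rotation t (act (K t) (p.rotation (-t) ρ)) - act L ρ
        = p.rotation t (act (K t - L) (p.rotation (-t) ρ)) := by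
      rw [act_sub, map_sub, hL, rotation_rotation_neg]
    calc _ = ‖(show AtomSpace from p.rotation t (act (K t - L) (p.rotation (-t) ρ)))‖ :=
          congrArg (fun X : AtomSpace => ‖X‖) e
      _ = ‖(show AtomSpace from act (K t - L) (p.rotation (-t) ρ))‖ := p.norm_rotation _ _
      _ ≤ ‖K t - L‖ * ‖(show AtomSpace from p.rotation (-t) ρ)‖ :=
          (K t - L).le_opNorm _
      _ = _ := by rw [norm_rotation]
  exact key

end Params

/-! ### The limiting generators -/

theorem mulOp_eq_mul (X Y : OpA) : mulOp X Y = X * Y := by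
  ext i j
  simp [mulOp, Matrix.mul_apply, tsum_fintype]

theorem dissipator_smul (l : ℝ) (L X : OpA) :
    dissipator ((l : ℂ) • L) X = ((l ^ 2 : ℝ) : ℂ) • dissipator L X := by
  simp only [dissipator, mulOp_eq_mul, Matrix.conjTranspose_smul, Complex.star_def,
    Complex.conj_ofReal, Matrix.smul_mul, Matrix.mul_smul]
  push_cast
  module

/-- In this form the coherences are eigenvectors, so covariance under rotations and comparison with
the limiting generators are entrywise. -/
theorem amplitudeDamping_eq (h r : ℂ) (X : OpA) :
    (-Complex.I) • commOp (h • (sigmaPlus * sigmaMinus)) X + r • dissipator sigmaMinus X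
      = !![r * X 1 1, (Complex.I * h - r / 2) * X 0 1;
          (-(Complex.I * h) - r / 2) * X 1 0, -r * X 1 1] := by
  ext a b
  fin_cases a <;> fin_cases b <;>
  simp [commOp, dissipator, mulOp_eq_mul, sigmaPlus, sigmaMinus, Matrix.mul_apply,
    Fin.sum_univ_two, Matrix.conjTranspose_apply, Matrix.vecMul, Matrix.vecHead, Matrix.vecTail] <;>
  ring

namespace Params

variable (p : Params)

theorem ofReal_norm_Gam_sq : ((‖p.Gam‖ ^ 2 : ℝ) : ℂ) = p.Gam * star p.Gam := by
  rw [Complex.star_def, Complex.mul_conj, Complex.normSq_eq_norm_sq]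

theorem ofReal_norm_g_sq : ((‖p.g‖ ^ 2 : ℝ) : ℂ) = p.g * star p.g := by
  rw [Complex.star_def, Complex.mul_conj, Complex.normSq_eq_norm_sq]

theorem star_Gam_eq : star p.Gam = Complex.I * p.detuning + p.gamma / 2 := by
  simp [Gam, detuning]

theorem ofReal_gamma : (p.gamma : ℂ) = p.Gam + star p.Gam := by
  rw [star_Gam_eq, Gam, detuning]; ring

theorem ofReal_detuning : (p.detuning : ℂ) = Complex.I * (p.Gam - star p.Gam) / 2 := by
  rw [star_Gam_eq, Gam, ← detuning]
  linear_combination (p.detuning : ℂ) * Complex.I_mul_I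

theorem Gam_re : p.Gam.re = p.gamma / 2 := by
  simp [Gam]

theorem star_Gam_re : (star p.Gam).re = p.gamma / 2 := by
  rw [Complex.star_def, Complex.conj_re, Gam_re]

theorem Gam_ne_zero (hγ : 0 < p.gamma) : p.Gam ≠ 0 := fun h => by
  have := p.Gam_re
  rw [h, Complex.zero_re] at this
  linarith

theorem star_Gam_ne_zero (hγ : 0 < p.gamma) : star p.Gam ≠ 0 :=
  star_ne_zero.mpr (p.Gam_ne_zero hγ)

/-- The shift `|g|² Δω / |Γ|²`. -/
def shift2 : ℝ := ‖p.g‖ ^ 2 * p.detuning / ‖p.Gam‖ ^ 2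

/-- The rate `γ |g|² / |Γ|²`. -/
def rate2 : ℝ := (Real.sqrt p.gamma * ‖p.g‖ / ‖p.Gam‖) ^ 2

/-- The shift `|g|⁴ Δω (γ² - |Γ|²) / |Γ|⁶`. -/
def shift4 : ℝ := ‖p.g‖ ^ 4 * (p.detuning * (p.gamma ^ 2 - ‖p.Gam‖ ^ 2) / ‖p.Gam‖ ^ 6)

theorem gksl_two (ρ : OpA) : gksl p.H2 p.L2 ρ =
    (-Complex.I) • commOp ((p.shift2 : ℂ) • (sigmaPlus * sigmaMinus)) ρ
      + (p.rate2 : ℂ) • dissipator sigmaMinus ρ := by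
  rw [gksl, L2, dissipator_smul]; rfl

theorem gksl_four (hγ : 0 < p.gamma) (h : 4 * p.detuning ^ 2 ≤ ‖p.Gam‖ ^ 2) (ρ : OpA) :
    gksl p.H4 p.L4 ρ =
      (-Complex.I) • commOp p.H4 ρ + (p.rate4 : ℂ) • dissipator sigmaMinus ρ := by
  have h0 : 0 ≤ p.gamma * (‖p.Gam‖ ^ 2 - 4 * p.detuning ^ 2) / ‖p.Gam‖ ^ 6 :=
    div_nonneg (mul_nonneg hγ.le (sub_nonneg.mpr h)) (by positivity)
  rw [gksl, L4, dissipator_smul, mul_pow, Real.sq_sqrt h0, rate4]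
  congr 4
  ring

theorem rate2_eq (hγ : 0 < p.gamma) :
    (p.rate2 : ℂ) = p.g * star p.g * (p.Gam⁻¹ + (star p.Gam)⁻¹) := by
  have h1 := p.Gam_ne_zero hγ
  have h2 := p.star_Gam_ne_zero hγ
  rw [rate2, div_pow, mul_pow, Real.sq_sqrt hγ.le, Complex.ofReal_div, Complex.ofReal_mul,
    ofReal_norm_g_sq, ofReal_norm_Gam_sq, ofReal_gamma]
  field_simp
  ring

theorem shift2_eq (hγ : 0 < p.gamma) : (p.shift2 : ℂ)
    = p.g * star p.g * (Complex.I / 2 * ((star p.Gam)⁻¹ - p.Gam⁻¹)) := by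
  have h1 := p.Gam_ne_zero hγ
  have h2 := p.star_Gam_ne_zero hγ
  rw [shift2, Complex.ofReal_div, Complex.ofReal_mul, ofReal_norm_g_sq, ofReal_norm_Gam_sq,
    ofReal_detuning]
  field_simp

/-- Uses `Γ³ + Γ̄³ = (Γ + Γ̄)(|Γ|² + (Γ - Γ̄)²)` with `Γ + Γ̄ = γ` and `(Γ - Γ̄)² = -4Δω²`. -/
theorem rate4_eq (hγ : 0 < p.gamma) : (p.rate4 : ℂ)
    = (p.g * star p.g) ^ 2 * ((p.Gam⁻¹) ^ 3 + ((star p.Gam)⁻¹) ^ 3) := by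
  have h1 := p.Gam_ne_zero hγ
  have h2 := p.star_Gam_ne_zero hγ
  have hd : (Complex.I * (p.Gam - star p.Gam) / 2) ^ 2 = -((p.Gam - star p.Gam) ^ 2 / 4) := by
    rw [div_pow, mul_pow, Complex.I_sq]; ring
  rw [rate4, show ‖p.g‖ ^ 4 = (‖p.g‖ ^ 2) ^ 2 by ring, show ‖p.Gam‖ ^ 6 = (‖p.Gam‖ ^ 2) ^ 3 by ring,
    Complex.ofReal_mul, Complex.ofReal_div, Complex.ofReal_mul, Complex.ofReal_sub,
    Complex.ofReal_mul, Complex.ofReal_pow, Complex.ofReal_pow (‖p.Gam‖ ^ 2) 3,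
    Complex.ofReal_pow p.detuning 2, ofReal_norm_g_sq, ofReal_norm_Gam_sq, ofReal_gamma,
    ofReal_detuning, hd]
  push_cast
  field_simp
  ring

/-- Uses `Γ³ - Γ̄³ = (Γ - Γ̄)((Γ + Γ̄)² - |Γ|²)` with `Γ - Γ̄ = -2iΔω`. -/
theorem shift4_eq (hγ : 0 < p.gamma) : (p.shift4 : ℂ)
    = (p.g * star p.g) ^ 2 * (Complex.I / 2 * (((star p.Gam)⁻¹) ^ 3 - (p.Gam⁻¹) ^ 3)) := by
  have h1 := p.Gam_ne_zero hγ
  have h2 := p.star_Gam_ne_zero hγ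
  rw [shift4, show ‖p.g‖ ^ 4 = (‖p.g‖ ^ 2) ^ 2 by ring,
    show ‖p.Gam‖ ^ 6 = (‖p.Gam‖ ^ 2) ^ 3 by ring,
    Complex.ofReal_mul, Complex.ofReal_div, Complex.ofReal_mul, Complex.ofReal_sub,
    Complex.ofReal_pow, Complex.ofReal_pow (‖p.Gam‖ ^ 2) 3,
    Complex.ofReal_pow p.gamma 2, ofReal_norm_g_sq, ofReal_norm_Gam_sq, ofReal_gamma,
    ofReal_detuning]
  field_simp
  ring

theorem superOp_ext {S T : SuperOp} (h : ∀ X, act S X = act T X) : S = T :=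
  ContinuousLinearMap.ext h

theorem lowerLeft_sq : toSuperOp p.lowerLeft * toSuperOp p.lowerLeft = 0 := by
  refine superOp_ext fun X => ?_
  rw [act_mul, act_toSuperOp, act_zero]
  ext a b
  simp only [lowerLeft, LinearMap.smul_apply, LinearMap.mulLeft_apply, Matrix.smul_apply,
    Matrix.mul_apply, Fin.sum_univ_two, smul_eq_mul]
  fin_cases a <;> fin_cases b <;> simp [sigmaMinus]

theorem raiseRight_sq : toSuperOp p.raiseRight * toSuperOp p.raiseRight = 0 := by
  refine superOp_ext fun X => ?_
  rw [act_mul, act_toSuperOp, act_zero]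
  ext a b
  simp only [raiseRight, LinearMap.smul_apply, LinearMap.mulRight_apply, Matrix.smul_apply,
    Matrix.mul_apply, Fin.sum_univ_two, smul_eq_mul]
  fin_cases a <;> fin_cases b <;> simp [sigmaPlus]

theorem raiseComm_eq (X : OpA) : p.raiseComm X = !![Complex.I * p.g * X 0 1, 0;
    -Complex.I * p.g * (X 0 0 - X 1 1), -Complex.I * p.g * X 0 1] := by
  ext a b
  simp only [raiseComm, LinearMap.smul_apply, LinearMap.sub_apply, LinearMap.mulLeft_apply,
    LinearMap.mulRight_apply, Matrix.smul_apply, Matrix.sub_apply, Matrix.mul_apply,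
    Fin.sum_univ_two, smul_eq_mul]
  fin_cases a <;> fin_cases b <;> simp [sigmaPlus]

theorem lowerComm_eq (X : OpA) : p.lowerComm X = !![-Complex.I * star p.g * X 1 0,
    -Complex.I * star p.g * (X 1 1 - X 0 0); 0, Complex.I * star p.g * X 1 0] := by
  ext a b
  simp only [lowerComm, LinearMap.smul_apply, LinearMap.sub_apply, LinearMap.mulLeft_apply,
    LinearMap.mulRight_apply, Matrix.smul_apply, Matrix.sub_apply, Matrix.mul_apply,
    Fin.sum_univ_two, smul_eq_mul]
  fin_cases a <;> fin_cases b <;> simp [sigmaMinus]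

theorem lowerLeft_eq (X : OpA) : p.lowerLeft X = !![-Complex.I * star p.g * X 1 0,
    -Complex.I * star p.g * X 1 1; 0, 0] := by
  ext a b
  simp only [lowerLeft, LinearMap.smul_apply, LinearMap.mulLeft_apply, Matrix.smul_apply,
    Matrix.mul_apply, Fin.sum_univ_two, smul_eq_mul]
  fin_cases a <;> fin_cases b <;> simp [sigmaMinus]

theorem raiseRight_eq (X : OpA) : p.raiseRight X = !![Complex.I * p.g * X 0 1, 0;
    Complex.I * p.g * X 1 1, 0] := by
  ext a b
  simp only [raiseRight, LinearMap.smul_apply, LinearMap.mulRight_apply, Matrix.smul_apply,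
    Matrix.mul_apply, Fin.sum_univ_two, smul_eq_mul]
  fin_cases a <;> fin_cases b <;> simp [sigmaPlus]

/-- The limit of the second order time-local generator. -/
def limitTwo : SuperOp :=
  p.Gam⁻¹ • (toSuperOp p.raiseComm * toSuperOp p.lowerLeft)
    + (star p.Gam)⁻¹ • (toSuperOp p.lowerComm * toSuperOp p.raiseRight)

/-- The limit of the fourth order time-local generator. -/
def limitFour : SuperOp :=
  toSuperOp p.raiseComm * (p.Gam⁻¹ • (toSuperOp p.lowerComm * ((p.Gam + star p.Gam)⁻¹ •
      ((star p.Gam)⁻¹ • (toSuperOp p.lowerLeft * toSuperOp p.raiseRight)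
        + p.Gam⁻¹ • (toSuperOp p.raiseRight * toSuperOp p.lowerLeft)))
      - (p.Gam⁻¹ • toSuperOp p.lowerLeft) * p.limitTwo))
    + toSuperOp p.lowerComm * ((star p.Gam)⁻¹ • (toSuperOp p.raiseComm *
      ((star p.Gam + p.Gam)⁻¹ •
      (p.Gam⁻¹ • (toSuperOp p.raiseRight * toSuperOp p.lowerLeft)
        + (star p.Gam)⁻¹ • (toSuperOp p.lowerLeft * toSuperOp p.raiseRight)))
      - ((star p.Gam)⁻¹ • toSuperOp p.raiseRight) * p.limitTwo))

theorem limitTwo_apply (hγ : 0 < p.gamma) (ρ : OpA) : act p.limitTwo ρ =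
    (-Complex.I) • commOp ((p.shift2 : ℂ) • (sigmaPlus * sigmaMinus)) ρ
      + (p.rate2 : ℂ) • dissipator sigmaMinus ρ := by
  have h1 := p.Gam_ne_zero hγ
  have h2 := p.star_Gam_ne_zero hγ
  have hI : Complex.I ^ 2 = -1 := Complex.I_sq
  rw [amplitudeDamping_eq, rate2_eq p hγ, shift2_eq p hγ]
  simp only [limitTwo, act_add, act_smul, act_mul, act_toSuperOp, raiseComm_eq, lowerComm_eq,
    lowerLeft_eq, raiseRight_eq]
  generalize p.Gam = G at h1 ⊢
  ext a b
  fin_cases a <;> fin_cases b <;> simp <;> ring_nf <;> simp only [hI] <;> ring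

theorem limitFour_apply (hγ : 0 < p.gamma) (ρ : OpA) : act p.limitFour ρ =
    (-Complex.I) • commOp ((p.shift4 : ℂ) • (sigmaPlus * sigmaMinus)) ρ
      + (p.rate4 : ℂ) • dissipator sigmaMinus ρ := by
  have h1 := p.Gam_ne_zero hγ
  have h2 := p.star_Gam_ne_zero hγ
  have h3 : p.Gam + star p.Gam ≠ 0 := by
    rw [← ofReal_gamma]; exact_mod_cast hγ.ne'
  -- Left and right multiplications commute, so `CD = DC` and the limit of `S₁₁` collapses to `|Γ|⁻²
  -- DC`.
  have e : (p.Gam + star p.Gam)⁻¹ * ((star p.Gam)⁻¹ + p.Gam⁻¹) = p.Gam⁻¹ * (star p.Gam)⁻¹ := by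
    field_simp
  have hI : Complex.I ^ 2 = -1 := Complex.I_sq
  have hI4 : Complex.I ^ 4 = 1 := Complex.I_pow_four
  have hCD : ∀ X, p.lowerLeft (p.raiseRight X) = p.raiseRight (p.lowerLeft X) := fun X => by
    rw [lowerLeft_eq, raiseRight_eq, lowerLeft_eq, raiseRight_eq]
    ext a b
    fin_cases a <;> fin_cases b <;> simp
    ring
  have hX : ∀ X, act ((p.Gam + star p.Gam)⁻¹ •
      ((star p.Gam)⁻¹ • (toSuperOp p.lowerLeft * toSuperOp p.raiseRight)
        + p.Gam⁻¹ • (toSuperOp p.raiseRight * toSuperOp p.lowerLeft))) X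
      = (p.Gam⁻¹ * (star p.Gam)⁻¹) • p.raiseRight (p.lowerLeft X) := fun X => by
    simp only [act_smul, act_add, act_mul, act_toSuperOp, hCD]
    rw [← add_smul, smul_smul, e]
  have hX' : ∀ X, act ((star p.Gam + p.Gam)⁻¹ •
      (p.Gam⁻¹ • (toSuperOp p.raiseRight * toSuperOp p.lowerLeft)
        + (star p.Gam)⁻¹ • (toSuperOp p.lowerLeft * toSuperOp p.raiseRight))) X
      = (p.Gam⁻¹ * (star p.Gam)⁻¹) • p.raiseRight (p.lowerLeft X) := fun X => by
    rw [← hX X, add_comm (star p.Gam), add_comm (p.Gam⁻¹ • _)]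
  rw [amplitudeDamping_eq, rate4_eq p hγ, shift4_eq p hγ, limitFour, act_add, act_mul, act_mul,
    act_smul, act_smul, act_sub, act_sub, act_mul, act_mul, act_mul, act_mul, hX, hX', act_smul,
    act_smul, limitTwo_apply p hγ, amplitudeDamping_eq, rate2_eq p hγ, shift2_eq p hγ]
  simp only [act_toSuperOp, raiseComm_eq, lowerComm_eq, lowerLeft_eq, raiseRight_eq]
  clear e hX hX' hCD
  ext a b
  fin_cases a <;> fin_cases b <;> simp <;> ring_nf <;> simp only [hI, hI4] <;> ring

theorem rotation_amplitudeDamping (h r : ℂ) (t : ℝ) (X : OpA) :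
    p.rotation t ((-Complex.I) • commOp (h • (sigmaPlus * sigmaMinus)) X
      + r • dissipator sigmaMinus X)
      = (-Complex.I) • commOp (h • (sigmaPlus * sigmaMinus)) (p.rotation t X)
        + r • dissipator sigmaMinus (p.rotation t X) := by
  rw [amplitudeDamping_eq, amplitudeDamping_eq]
  have h00 : p.atomPhase t 0 0 = 1 := by simp [atomPhase]
  have h11 : p.atomPhase t 1 1 = 1 := by simp [atomPhase]
  ext a b
  fin_cases a <;> fin_cases b <;> simp [rotation_apply, h00, h11] <;> ring

theorem tendsto_cumulant_two (hγ : 0 < p.gamma) (ρ : OpA) :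
    Tendsto (fun t => p.cumulant 2 t ρ) atTop (𝓝 (gksl p.H2 p.L2 ρ)) := by
  have h1 : 0 < p.Gam.re := by rw [Gam_re]; positivity
  have h2 : 0 < (star p.Gam).re := by rw [star_Gam_re]; positivity
  simp only [cumulant_two_eq]
  rw [gksl_two, ← limitTwo_apply p hγ]
  have hL : Tendsto p.localGenTwo atTop (𝓝 p.limitTwo) := by
    unfold limitTwo
    exact p.isHierarchy_dysonCoeff.tendsto_localGen2 h1 h2
  refine p.tendsto_rotation_conj hL (fun t X => ?_) ρ
  rw [limitTwo_apply p hγ, limitTwo_apply p hγ, rotation_amplitudeDamping]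

theorem tendsto_cumulant_four (hγ : 0 < p.gamma) (ρ : OpA) :
    Tendsto (fun t => p.cumulant 4 t ρ) atTop
      (𝓝 ((-Complex.I) • commOp p.H4 ρ + (p.rate4 : ℂ) • dissipator sigmaMinus ρ)) := by
  have h1 : 0 < p.Gam.re := by rw [Gam_re]; positivity
  have h2 : 0 < (star p.Gam).re := by rw [star_Gam_re]; positivity
  simp only [cumulant_four_eq]
  change Tendsto _ _ (𝓝 ((-Complex.I) • commOp ((p.shift4 : ℂ) • (sigmaPlus * sigmaMinus)) ρ
    + (p.rate4 : ℂ) • dissipator sigmaMinus ρ))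
  rw [← limitFour_apply p hγ]
  have hL : Tendsto p.localGenFour atTop (𝓝 p.limitFour) := by
    have h := p.isHierarchy_dysonCoeff.tendsto_localGen4 h1 h2 p.lowerLeft_sq p.raiseRight_sq
    rw [add_comm ((star p.Gam)⁻¹ • (toSuperOp p.lowerComm * toSuperOp p.raiseRight))
      (p.Gam⁻¹ • _)] at h
    exact h
  refine p.tendsto_rotation_conj hL (fun t X => ?_) ρ
  rw [limitFour_apply p hγ, limitFour_apply p hγ, rotation_amplitudeDamping]

/-- Rate and shift are separately allowed to vanish, but not together: on the coherence `σ⁺` the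
limit is multiplication by `-|g|⁴Γ⁻³ ≠ 0`. -/
theorem not_tendsto_cumulant_four_zero (hγ : 0 < p.gamma) (hg : p.g ≠ 0) :
    ¬ ∀ ρ : OpA, Tendsto (fun t => p.cumulant 4 t ρ) atTop (𝓝 0) := by
  intro h0
  have e := tendsto_nhds_unique (p.tendsto_cumulant_four hγ sigmaPlus) (h0 sigmaPlus)
  change (-Complex.I) • commOp ((p.shift4 : ℂ) • (sigmaPlus * sigmaMinus)) sigmaPlus
    + (p.rate4 : ℂ) • dissipator sigmaMinus sigmaPlus = 0 at e
  rw [amplitudeDamping_eq, shift4_eq p hγ, rate4_eq p hγ] at e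
  have e' := congrFun (congrFun e 1) 0
  simp only [sigmaPlus, Matrix.of_apply, Matrix.cons_val', Matrix.cons_val_zero,
    Matrix.cons_val_one, Matrix.cons_val_fin_one, Matrix.zero_apply, mul_one] at e'
  have e2 : (p.g * star p.g) ^ 2 * (p.Gam⁻¹) ^ 3 = 0 := by
    linear_combination -e' + (1 / 2 : ℂ) * (p.g * star p.g) ^ 2 *
      (p.Gam⁻¹ ^ 3 - (star p.Gam)⁻¹ ^ 3) * Complex.I_sq
  exact mul_ne_zero (pow_ne_zero _ (mul_ne_zero hg (star_ne_zero.mpr hg)))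
    (pow_ne_zero _ (inv_ne_zero (p.Gam_ne_zero hγ))) e2

end Params

end JaynesCummings

end

theorem mainTheorem6 (p : JaynesCummings.Params) (hγ : 0 < p.gamma) :
    -- the cumulants up to order four exist
    p.WellDefined 4 ∧
    -- the limit of the second-order cumulant is the GKSL generator given by `H2`, `L2`
    (∀ ρ : JaynesCummings.OpA,
      Filter.Tendsto (fun t : ℝ => p.cumulant 2 t ρ) Filter.atTop
        (nhds (JaynesCummings.gksl p.H2 p.L2 ρ))) ∧
    -- the limit of the fourth-order cumulant, for either sign of `rate4`
    (∀ ρ : JaynesCummings.OpA,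
      Filter.Tendsto (fun t : ℝ => p.cumulant 4 t ρ) Filter.atTop
        (nhds ((-Complex.I) • JaynesCummings.commOp p.H4 ρ
          + (p.rate4 : ℂ) • JaynesCummings.dissipator JaynesCummings.sigmaMinus ρ))) ∧
    -- the limit is a GKSL generator with Lindblad operator `L4` when `rate4` is nonnegative
    (4 * p.detuning ^ 2 ≤ ‖p.Gam‖ ^ 2 → ∀ ρ : JaynesCummings.OpA,
      Filter.Tendsto (fun t : ℝ => p.cumulant 4 t ρ) Filter.atTop
        (nhds (JaynesCummings.gksl p.H4 p.L4 ρ))) ∧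
    -- the fourth-order cumulant does not vanish as `t → ∞`
    (p.g ≠ 0 → ¬ ∀ ρ : JaynesCummings.OpA,
      Filter.Tendsto (fun t : ℝ => p.cumulant 4 t ρ) Filter.atTop (nhds 0)) := by
  refine ⟨p.wellDefined 4, p.tendsto_cumulant_two hγ, p.tendsto_cumulant_four hγ,
    fun h ρ => ?_, p.not_tendsto_cumulant_four_zero hγ⟩
  rw [p.gksl_four hγ h]
  exact p.tendsto_cumulant_four hγ ρ
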